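/- There is an algorithm, running in time polynomial in $n+m$, that does the following. The input is a finite digraph $D=(V,A)$ with $n=|V|$ nodes and $m=|A|$ arcs (parallel arcs and loops allowed), a node $r\in V$ and a cost function $c:A\to\mathbb{R}$, where $A\neq\emptyset$ or $V=\{r\}$. The output is a subset $A'\subseteq A$, a graphic matroid $M_1$ on ground set $A'$ (given by a finite undirected multigraph with edge set $A'$, whose forests are the independent sets of $M_1$) and a partition matroid $M_2$ on ground set $A'$ (given by a partition of $A'$; a set is independent in $M_2$ if it contains at most one element of each class), such that for every $B\subseteq A$: $B$ is a minimum $c$-cost $r$-arborescence of $D$ if and only if $B\subseteq A'$ and $B$ is a common base of $M_1$ and $M_2$. Here an $r$-arborescence is a set $B\subseteq A$ that contains no cycle (in the undirected sense) and is such that no arc of $B$ enters $r$ and exactly one arc of $B$ enters each node $v\ne r$; it is a minimum $c$-cost one if $c(B)=\sum_{a\in B}c(a)$ is smallest among all $r$-arborescences. An algorithm is a program of a random access machine with integer and real cells, and its running time is the number of operations: it may add, (truncatedly) subtract and compare natural numbers and use them as (pairs of) addresses, and it may add, subtract and compare real numbers. -/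

import Mathlib

/-! ### Forests, cycle matroids and partition matroids -/

namespace OptArb

/-- The edge set `I` of the multigraph `G` contains a cycle: `k ≥ 1` distinct vertices
`v 0, …, v (k - 1)` and `k` distinct edges `e 0, …, e (k - 1)` of `I`, where `e i` joins `v i` to
`v (i + 1)` and `v k = v 0`. A loop is a cycle with `k = 1`, two parallel edges form one
with `k = 2`. -/
def ContainsCycle {V E : Type*} (G : Graph V E) (I : Set E) : Prop :=
  ∃ (k : ℕ) (v : ℕ → V) (e : ℕ → E), 0 < k ∧ v k = v 0 ∧
    Set.InjOn v (Set.Iio k) ∧ Set.InjOn e (Set.Iio k) ∧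
    ∀ i < k, e i ∈ I ∧ G.IsLink (e i) (v i) (v (i + 1))

/-- `M` is the cycle matroid of the multigraph `G`: its ground set is the edge set, and its
independent sets are the forests. -/
def IsCycleMatroid {V E : Type*} (G : Graph V E) (M : Matroid E) : Prop :=
  M.E = G.edgeSet ∧ ∀ I : Set E, M.Indep I ↔ I ⊆ G.edgeSet ∧ ¬ ContainsCycle G I

/-- `M` is the partition matroid on the ground set `S` whose classes are the sets of elements of
`S` with equal labels: a set is independent if it has at most one element in each class. -/
def IsPartitionMatroid {E : Type*} (S : Set E) (label : E → ℕ) (M : Matroid E) : Prop :=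
  M.E = S ∧ ∀ I : Set E, M.Indep I ↔ I ⊆ S ∧ ∀ j : ℕ, {e ∈ I | label e = j}.encard ≤ 1

/-! ### Digraphs and arborescences -/

/-- A digraph with node set `V` and arc set `A`; parallel arcs and loops are allowed. -/
structure MultiDigraph (V A : Type*) where
  tail : A → V
  head : A → V

/-- The underlying undirected multigraph of a digraph. -/
def MultiDigraph.toGraph {V A : Type*} (D : MultiDigraph V A) : Graph V A where
  vertexSet := Set.univ
  IsLink a x y := (D.tail a = x ∧ D.head a = y) ∨ (D.tail a = y ∧ D.head a = x)
  isLink_symm a _ := ⟨fun _ _ h => h.symm⟩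
  eq_or_eq_of_isLink_of_isLink := by
    rintro a x y v w (⟨rfl, rfl⟩ | ⟨rfl, rfl⟩) (⟨rfl, rfl⟩ | ⟨rfl, rfl⟩) <;> simp
  left_mem_of_isLink := fun _ _ _ _ => Set.mem_univ _

/-- `B` is a (spanning) `r`-arborescence: no arc of `B` enters `r`, exactly one arc of `B` enters
each other node, and `B` contains no cycle (in the undirected sense). -/
def MultiDigraph.IsArborescence {V A : Type*} (D : MultiDigraph V A) (r : V) (B : Finset A) :
    Prop :=
  (∀ a ∈ B, D.head a ≠ r) ∧ (∀ v, v ≠ r → ∃! a, a ∈ B ∧ D.head a = v) ∧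
    ¬ ContainsCycle D.toGraph (B : Set A)

/-- `B` is an `r`-arborescence of minimum `c`-cost. -/
def MultiDigraph.IsMinCostArborescence {V A : Type*} (D : MultiDigraph V A) (r : V) (c : A → ℝ)
    (B : Finset A) : Prop :=
  D.IsArborescence r B ∧
    ∀ B' : Finset A, D.IsArborescence r B' → ∑ a ∈ B, c a ≤ ∑ a ∈ B', c a

/-! ### The machine model

A random access machine with natural-number cells and real-number cells. Naturals can be added,
(truncatedly) subtracted, compared, and used as addresses; reals can be added, subtracted and
compared. There is no multiplication, no rounding and no conversion between the two kinds, and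
the only constants are naturals. Every operation costs one step. -/

/-- The memory: finitely many numbered tables of each kind are accessible to a given program, and
the cells of each table are addressed by pairs of naturals. -/
structure Memory where
  nat : ℕ → ℕ → ℕ → ℕ
  real : ℕ → ℕ → ℕ → ℝ

/-- Expressions with natural-number values. `read T i j` is the cell `(i, j)` of table `T`. -/
inductive NatExpr : Type
  | const (k : ℕ)
  | read (table : ℕ) (i j : NatExpr)
  | add (x y : NatExpr)
  | sub (x y : NatExpr)

/-- The value of an expression. -/
def NatExpr.eval (s : Memory) : NatExpr → ℕ
  | .const k => k
  | .read T i j => s.nat T (i.eval s) (j.eval s)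
  | .add x y => x.eval s + y.eval s
  | .sub x y => x.eval s - y.eval s

/-- The number of operations needed to evaluate an expression. -/
def NatExpr.ops : NatExpr → ℕ
  | .const _ => 1
  | .read _ i j => 1 + i.ops + j.ops
  | .add x y => 1 + x.ops + y.ops
  | .sub x y => 1 + x.ops + y.ops

/-- Expressions with real values. -/
inductive RealExpr : Type
  | zero
  | read (table : ℕ) (i j : NatExpr)
  | add (x y : RealExpr)
  | sub (x y : RealExpr)

/-- The value of an expression. -/
noncomputable def RealExpr.eval (s : Memory) : RealExpr → ℝ
  | .zero => 0
  | .read T i j => s.real T (i.eval s) (j.eval s)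
  | .add x y => x.eval s + y.eval s
  | .sub x y => x.eval s - y.eval s

/-- The number of operations needed to evaluate an expression. -/
def RealExpr.ops : RealExpr → ℕ
  | .zero => 1
  | .read _ i j => 1 + i.ops + j.ops
  | .add x y => 1 + x.ops + y.ops
  | .sub x y => 1 + x.ops + y.ops

/-- Tests. -/
inductive Test : Type
  | natEq (x y : NatExpr)
  | natLt (x y : NatExpr)
  | realEq (x y : RealExpr)
  | realLt (x y : RealExpr)
  | not (b : Test)
  | and (b b' : Test)
  | or (b b' : Test)

/-- The truth value of a test. -/
def Test.Holds (s : Memory) : Test → Prop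
  | .natEq x y => x.eval s = y.eval s
  | .natLt x y => x.eval s < y.eval s
  | .realEq x y => x.eval s = y.eval s
  | .realLt x y => x.eval s < y.eval s
  | .not b => ¬ b.Holds s
  | .and b b' => b.Holds s ∧ b'.Holds s
  | .or b b' => b.Holds s ∨ b'.Holds s

/-- The number of operations needed to evaluate a test. -/
def Test.ops : Test → ℕ
  | .natEq x y => 1 + x.ops + y.ops
  | .natLt x y => 1 + x.ops + y.ops
  | .realEq x y => 1 + x.ops + y.ops
  | .realLt x y => 1 + x.ops + y.ops
  | .not b => 1 + b.ops
  | .and b b' => 1 + b.ops + b'.ops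
  | .or b b' => 1 + b.ops + b'.ops

/-- Programs. `setNat T i j x` and `setReal T i j x` write the value of `x` to the cell `(i, j)`
of table `T`. -/
inductive Program : Type
  | skip
  | setNat (table : ℕ) (i j x : NatExpr)
  | setReal (table : ℕ) (i j : NatExpr) (x : RealExpr)
  | seq (p q : Program)
  | ite (b : Test) (p q : Program)
  | while (b : Test) (p : Program)

/-- The table family `f` with the cell `(i, j)` of table `T` overwritten by `x`. -/
def writeCell {α : Type*} (f : ℕ → ℕ → ℕ → α) (T i j : ℕ) (x : α) : ℕ → ℕ → ℕ → α :=
  fun T' i' j' => if T' = T ∧ i' = i ∧ j' = j then x else f T' i' j'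

/-- `Runs p s t s'`: the program `p`, started with memory `s`, halts after exactly `t` steps with
memory `s'`. -/
inductive Runs : Program → Memory → ℕ → Memory → Prop
  | skip (s : Memory) : Runs .skip s 1 s
  | setNat (T : ℕ) (i j x : NatExpr) (s : Memory) :
      Runs (.setNat T i j x) s (1 + i.ops + j.ops + x.ops)
        { s with nat := writeCell s.nat T (i.eval s) (j.eval s) (x.eval s) }
  | setReal (T : ℕ) (i j : NatExpr) (x : RealExpr) (s : Memory) :
      Runs (.setReal T i j x) s (1 + i.ops + j.ops + x.ops)
        { s with real := writeCell s.real T (i.eval s) (j.eval s) (x.eval s) }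
  | seq {p q : Program} {s s' s'' : Memory} {t t' : ℕ} :
      Runs p s t s' → Runs q s' t' s'' → Runs (.seq p q) s (t + t') s''
  | ite_true {b : Test} {p : Program} (q : Program) {s s' : Memory} {t : ℕ} :
      b.Holds s → Runs p s t s' → Runs (.ite b p q) s (b.ops + t) s'
  | ite_false {b : Test} (p : Program) {q : Program} {s s' : Memory} {t : ℕ} :
      ¬ b.Holds s → Runs q s t s' → Runs (.ite b p q) s (b.ops + t) s'
  | while_true {b : Test} {p : Program} {s s' s'' : Memory} {t t' : ℕ} :
      b.Holds s → Runs p s t s' → Runs (.while b p) s' t' s'' →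
      Runs (.while b p) s (b.ops + t + t') s''
  | while_false {b : Test} (p : Program) {s : Memory} :
      ¬ b.Holds s → Runs (.while b p) s b.ops s

/-! ### Input and output -/

/-- The input. Table `0` of naturals holds the number of nodes, the number of arcs and the root in
its cells `(0, 0)`, `(1, 0)`, `(2, 0)`; tables `1` and `2` of naturals hold the tail and the head
of the arc `a`, and table `0` of reals its cost, in the cell `(a, 0)`. All other cells are `0`. -/
def input {n m : ℕ} (D : MultiDigraph (Fin n) (Fin m)) (r : Fin n) (c : Fin m → ℝ) : Memory where
  nat T i j :=
    match T, i, j with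
    | 0, 0, 0 => n
    | 0, 1, 0 => m
    | 0, 2, 0 => r
    | 1, a, 0 => if h : a < m then D.tail ⟨a, h⟩ else 0
    | 2, a, 0 => if h : a < m then D.head ⟨a, h⟩ else 0
    | _, _, _ => 0
  real T i j :=
    match T, i, j with
    | 0, a, 0 => if h : a < m then c ⟨a, h⟩ else 0
    | _, _, _ => 0

/-- The arc set in the output: the arcs whose cell `(a, 0)` in table `3` holds `1`. -/
def outputArcs (m : ℕ) (s : Memory) : Set (Fin m) := {a | s.nat 3 a 0 = 1}

/-- `G` is the multigraph in the output: its nodes are `0, …, k - 1`, where `k` is the cell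
`(0, 0)` of table `4`, its edges are the arcs in the output, and the two ends of the edge `a` are
the cells `(a, 0)` of tables `5` and `6`. -/
def IsOutputGraph {m : ℕ} (s : Memory) (G : Graph ℕ (Fin m)) : Prop :=
  G.vertexSet = Set.Iio (s.nat 4 0 0) ∧
    ∀ a x y, G.IsLink a x y ↔ a ∈ outputArcs m s ∧
      ((s.nat 5 a 0 = x ∧ s.nat 6 a 0 = y) ∨ (s.nat 5 a 0 = y ∧ s.nat 6 a 0 = x))

/-- The partition classes in the output: the class of the arc `a` is labelled by the cell `(a, 0)`
of table `7`. -/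
def outputLabel {m : ℕ} (s : Memory) (a : Fin m) : ℕ := s.nat 7 a 0

/-- The output is the arc set `A'`, the graphic matroid `M₁` on `A'` (given by a finite multigraph
with edge set `A'`) and the partition matroid `M₂` on `A'` (given by its classes). -/
def IsOutput {m : ℕ} (s : Memory) (A' : Set (Fin m)) (M₁ M₂ : Matroid (Fin m)) : Prop :=
  A' = outputArcs m s ∧
    (∃ G : Graph ℕ (Fin m), IsOutputGraph s G ∧ IsCycleMatroid G M₁) ∧
    IsPartitionMatroid A' (outputLabel s) M₂

end OptArb

/-! The proof is dual ascent on a laminar family of node sets, followed by a graph that encodes the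
laminar constraints. While the marked (tight) arcs do not reach every node from `r`, some strong
component `S` of the marked digraph avoids `r` and is entered by no marked arc. The reduced costs of
the arcs entering `S` are lowered by their minimum, which becomes the dual variable of `S`, and the
arcs that drop to zero are marked. If no arc enters `S`, there is no arborescence. A dual variable
can be negative only for a singleton, which every arborescence enters exactly once anyway
(`Stage.step`, `Stage.excess_nonneg`). By complementary slackness (`Stage.cost_eq`) the minimum
arborescences are the arborescences of marked arcs that enter each raised set `Z i` exactly once,
provided one exists. Growing from `r` by the earliest marked arc produces one
(`Stage.exists_tight`).

It remains to express "enters each `Z i` once" by matroids. In-degree one is the partition matroid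
of the heads. For sets of in-degree one, entering `Z i` once amounts to being connected inside `Z i`
(`Stage.tight_iff_connIn`). So for each member of the family, contracting its maximal proper
submembers must leave a connected graph. These level graphs are glued into one graph on the nodes by
letting the least node of a contracted set stand for it: arc `a` joins `rep (tail a) (head a)` to
`rep (head a) (tail a)`. Arcs not inside `Z i` then meet `Z i` only in its least node, so
connectivity of the glued graph splits into connectivity at all levels (`Stage.tight_iff`). Forests
are treated as linearly independent sets of vectors `x - y`; with one edge less than nodes, forest
and connected mean the same.

For the machine, the algorithm is written with bounded loops, which have a functional semantics
`Code.den` and a polynomial bound `Code.cost` (`Code.exists_runs`). Each successful round marks a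
new arc, so one round more than there are arcs suffices. If there is no arborescence, the output is
a single loop edge: then `M₁` has rank 0 and `M₂` rank 1, so no common base exists. -/

namespace OptArb

/-! ### Linear matroids and cycles -/

section Linear

variable {E W : Type*}

/-- Elements of a finite set labelled by vectors form a matroid under linear independence. -/
theorem exists_linear_matroid {K : Type*} [Field K] [AddCommGroup W] [Module K W] [Finite E]
    (S : Set E) (f : E → W) :
    ∃ M : Matroid E, M.E = S ∧ ∀ I, M.Indep I ↔ I ⊆ S ∧ LinearIndepOn K f I := by
  refine ⟨(IndepMatroid.ofFinite (E := S) S.toFinite (fun I => I ⊆ S ∧ LinearIndepOn K f I)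
    ⟨Set.empty_subset _, linearIndepOn_empty K f⟩
    (fun I J hJ hIJ => ⟨hIJ.trans hJ.1, hJ.2.mono hIJ⟩) ?_ (fun I h => h.1)).matroid, rfl,
    fun I => Iff.rfl⟩
  rintro I J ⟨hIS, hI⟩ ⟨hJS, hJ⟩ hlt
  by_contra hcon
  push Not at hcon
  have hsub : Submodule.span K (f '' J) ≤ Submodule.span K (f '' I) := by
    rw [Submodule.span_le]
    rintro _ ⟨e, he, rfl⟩
    by_cases heI : e ∈ I
    · exact Submodule.subset_span ⟨e, heI, rfl⟩
    · by_contra hn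
      exact hcon e he heI (Set.insert_subset (hJS he) hIS)
        ((linearIndepOn_insert heI).2 ⟨hI, hn⟩)
  classical
  have key : ∀ S : Set E, LinearIndepOn K f S →
      Module.finrank K (Submodule.span K (f '' S)) = S.ncard := by
    intro S hS
    have := Fintype.ofFinite S
    have h := finrank_span_eq_card (R := K) (b := fun i : S => f i) hS
    rw [← Nat.card_coe_set_eq, Nat.card_eq_fintype_card, ← h, Set.image_eq_range]
  have : FiniteDimensional K (Submodule.span K (f '' I)) :=
    FiniteDimensional.span_of_finite K (I.toFinite.image f)
  have := Submodule.finrank_mono hsub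
  rw [key I hI, key J hJ] at this
  omega

/-- The vector of an edge with ends `X e` and `Y e`. -/
noncomputable def edgeVec (X Y : E → W) (e : E) : W →₀ ℚ :=
  Finsupp.single (X e) 1 - Finsupp.single (Y e) 1

/-- Two nodes are joined by edges in `I`. -/
def Conn (X Y : E → W) (I : Set E) : W → W → Prop :=
  Relation.EqvGen (fun u v => ∃ e ∈ I, X e = u ∧ Y e = v)

/-- The functional that adds the coefficients over the component of `u` kills all edge vectors of
`I`, and it is 1 on the difference unless `v` is in that component. Conversely, the edge vectors
along a walk telescope. -/
theorem single_sub_single_mem_span_iff (X Y : E → W) (I : Set E) (u v : W) :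
    (Finsupp.single u 1 - Finsupp.single v 1 : W →₀ ℚ) ∈ Submodule.span ℚ (edgeVec X Y '' I) ↔
      Conn X Y I u v := by
  classical
  constructor
  · intro h
    let φ : (W →₀ ℚ) →ₗ[ℚ] ℚ :=
      Finsupp.linearCombination ℚ (fun w => if Conn X Y I u w then (1 : ℚ) else 0)
    have hφ : Submodule.span ℚ (edgeVec X Y '' I) ≤ LinearMap.ker φ := by
      rw [Submodule.span_le]
      rintro _ ⟨e, he, rfl⟩
      have h1 : Conn X Y I (X e) (Y e) := Relation.EqvGen.rel _ _ ⟨e, he, rfl, rfl⟩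
      have h2 : Conn X Y I u (X e) ↔ Conn X Y I u (Y e) :=
        ⟨fun h => h.trans _ _ _ h1, fun h => h.trans _ _ _ (h1.symm)⟩
      simp [φ, edgeVec, h2]
    have h0 : φ (Finsupp.single u 1 - Finsupp.single v 1) = 0 := hφ h
    have hr : Conn X Y I u u := Relation.EqvGen.refl _
    by_contra hn
    simp [φ, hr, hn] at h0
  · intro h
    induction h with
    | rel x y h =>
      obtain ⟨e, he, rfl, rfl⟩ := h
      exact Submodule.subset_span ⟨e, he, rfl⟩
    | refl x => simp
    | symm x y _ ih => simpa using Submodule.neg_mem _ ih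
    | trans x y z _ _ ih1 ih2 => simpa using Submodule.add_mem _ ih1 ih2

/-- The other edges, with suitable signs, telescope from `v 1` round to `v k = v 0`, so `e 0` is
redundant. For a loop the sum is empty and the vector is zero. -/
theorem not_linearIndepOn_edgeVec_of_containsCycle {G : Graph W E} {X Y : E → W} {S I : Set E}
    (hG : ∀ a x y, G.IsLink a x y ↔ a ∈ S ∧ ((X a = x ∧ Y a = y) ∨ (X a = y ∧ Y a = x)))
    (hc : ContainsCycle G I) : ¬ LinearIndepOn ℚ (edgeVec X Y) I := by
  obtain ⟨k, v, e, hk, hv0, -, he, hl⟩ := hc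
  rw [linearIndepOn_iff_notMem_span]
  push Not
  refine ⟨e 0, (hl 0 hk).1, ?_⟩
  have hvec : ∀ i < k, edgeVec X Y (e i) = Finsupp.single (v i) 1 - Finsupp.single (v (i + 1)) 1 ∨
      edgeVec X Y (e i) = Finsupp.single (v (i + 1)) 1 - Finsupp.single (v i) 1 := by
    intro i hi
    rcases ((hG _ _ _).1 (hl i hi).2).2 with ⟨h1, h2⟩ | ⟨h1, h2⟩
    · left; rw [edgeVec, h1, h2]
    · right; rw [edgeVec, h1, h2]
  have hsum : ∀ j, j + 1 ≤ k → (Finsupp.single (v 1) 1 - Finsupp.single (v (j + 1)) 1 : W →₀ ℚ) ∈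
      Submodule.span ℚ (edgeVec X Y '' (I \ {e 0})) := by
    intro j
    induction j with
    | zero => simp
    | succ j ih =>
      intro hj
      have h1 := ih (by omega)
      have h2 : edgeVec X Y (e (j + 1)) ∈ Submodule.span ℚ (edgeVec X Y '' (I \ {e 0})) := by
        refine Submodule.subset_span ⟨e (j + 1), ⟨(hl _ (by omega)).1, ?_⟩, rfl⟩
        intro h
        have := he (show j + 1 ∈ Set.Iio k from hj) (show 0 ∈ Set.Iio k from hk) h
        omega
      rcases hvec (j + 1) (by omega) with h | h
      · rw [h] at h2; simpa using Submodule.add_mem _ h1 h2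
      · rw [h] at h2; simpa using Submodule.sub_mem _ h1 h2
  have h1 := hsum (k - 1) (by omega)
  rw [Nat.sub_add_cancel hk, hv0] at h1
  rcases hvec 0 hk with h | h
  · rw [h]; simpa using Submodule.neg_mem _ h1
  · rw [h]; simpa using h1

/-- The ends of a redundant edge `e` are joined by the remaining edges. A path between them, closed
up by `e`, is the cycle. -/
theorem containsCycle_of_not_linearIndepOn_edgeVec {G : Graph W E} {X Y : E → W} {S I : Set E}
    (hG : ∀ a x y, G.IsLink a x y ↔ a ∈ S ∧ ((X a = x ∧ Y a = y) ∨ (X a = y ∧ Y a = x)))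
    (hIS : I ⊆ S) (hI : ¬ LinearIndepOn ℚ (edgeVec X Y) I) : ContainsCycle G I := by
  classical
  rw [linearIndepOn_iff_notMem_span] at hI
  push Not at hI
  obtain ⟨e, he, hs⟩ := hI
  rw [edgeVec, single_sub_single_mem_span_iff] at hs
  let H : SimpleGraph W := SimpleGraph.fromRel (fun u v => ∃ f ∈ I \ {e}, X f = u ∧ Y f = v)
  have hreach : ∀ u v, Conn X Y (I \ {e}) u v → H.Reachable u v := by
    intro u v h
    induction h with
    | rel x y h =>
      by_cases hxy : x = y
      · rw [hxy]
      · exact SimpleGraph.Adj.reachable (by rw [SimpleGraph.fromRel_adj]; exact ⟨hxy, Or.inl h⟩)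
    | refl x => exact SimpleGraph.Reachable.refl _
    | symm x y _ ih => exact ih.symm
    | trans x y z _ _ ih1 ih2 => exact ih1.trans ih2
  obtain ⟨p, hp⟩ := (hreach _ _ hs).symm.exists_isPath
  have hedge : ∀ i, ∃ f, i < p.length → f ∈ I ∧ f ≠ e ∧
      G.IsLink f (p.getVert i) (p.getVert (i + 1)) := by
    intro i
    by_cases hi : i < p.length
    · have := p.adj_getVert_succ hi
      rw [SimpleGraph.fromRel_adj] at this
      rcases this.2 with ⟨f, hf, h1, h2⟩ | ⟨f, hf, h1, h2⟩
      · exact ⟨f, fun _ => ⟨hf.1, hf.2, (hG _ _ _).2 ⟨hIS hf.1, Or.inl ⟨h1, h2⟩⟩⟩⟩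
      · exact ⟨f, fun _ => ⟨hf.1, hf.2, (hG _ _ _).2 ⟨hIS hf.1, Or.inr ⟨h1, h2⟩⟩⟩⟩
    · exact ⟨e, fun h => absurd h hi⟩
  choose f hf using hedge
  have hinj : ∀ i ≤ p.length, ∀ j ≤ p.length, p.getVert i = p.getVert j → i = j :=
    fun i hi j hj h => hp.getVert_injOn hi hj h
  -- Position `p.length + 1` returns to `Y e`, the start of the path, and the closing edge is `e`.
  -- If `e` is a loop, the path is empty and the cycle has one edge.
  refine ⟨p.length + 1, fun i => if i ≤ p.length then p.getVert i else Y e,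
    fun i => if i < p.length then f i else e, by omega, by simp, ?_, ?_, ?_⟩
  · intro i hi j hj h
    have hi' : i ≤ p.length := Nat.lt_succ_iff.1 hi
    have hj' : j ≤ p.length := Nat.lt_succ_iff.1 hj
    simp only [hi', hj', if_true] at h
    exact hinj i hi' j hj' h
  · intro i hi j hj h
    have hi' : i ≤ p.length := Nat.lt_succ_iff.1 hi
    have hj' : j ≤ p.length := Nat.lt_succ_iff.1 hj
    by_cases hi2 : i < p.length <;> by_cases hj2 : j < p.length
    · simp only [hi2, hj2, if_true] at h
      have h1 := (hf i hi2).2.2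
      rw [h] at h1
      rcases G.eq_or_eq_of_isLink_of_isLink h1 (hf j hj2).2.2 with h3 | h3
      · exact hinj _ hi' _ hj' h3
      -- If the ends were matched crosswise, this would give `i = j + 1` and `j = i + 1`.
      · rcases G.eq_or_eq_of_isLink_of_isLink (hf j hj2).2.2 h1 with h4 | h4
        · exact (hinj _ hj' _ hi' h4).symm
        · have := hinj _ hi' _ (by omega) h3
          have := hinj _ hj' _ (by omega) h4
          omega
    · simp only [hi2, hj2, if_true, if_false] at h
      exact absurd h (hf i hi2).2.1
    · simp only [hi2, hj2, if_true, if_false] at h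
      exact absurd h.symm (hf j hj2).2.1
    · omega
  · intro i hi
    by_cases hi2 : i < p.length
    · have h3 : i + 1 ≤ p.length := hi2
      simp only [hi2, hi2.le, h3, if_true]
      exact ⟨(hf i hi2).1, (hf i hi2).2.2⟩
    · have h3 : i = p.length := by omega
      subst h3
      simp [he, hG, hIS he]

theorem containsCycle_iff_not_linearIndepOn_edgeVec {G : Graph W E} {X Y : E → W} {S I : Set E}
    (hG : ∀ a x y, G.IsLink a x y ↔ a ∈ S ∧ ((X a = x ∧ Y a = y) ∨ (X a = y ∧ Y a = x)))
    (hIS : I ⊆ S) : ContainsCycle G I ↔ ¬ LinearIndepOn ℚ (edgeVec X Y) I :=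
  ⟨not_linearIndepOn_edgeVec_of_containsCycle hG,
    containsCycle_of_not_linearIndepOn_edgeVec hG hIS⟩

/-- The space spanned by the edges of a connected graph. -/
theorem span_edgeVec_eq_ker {X Y : E → W} {I : Set E} (r : W)
    (h : ∀ v, Conn X Y I r v) :
    Submodule.span ℚ (edgeVec X Y '' I) =
      LinearMap.ker (Finsupp.linearCombination ℚ (fun _ : W => (1 : ℚ))) := by
  apply le_antisymm
  · rw [Submodule.span_le]
    rintro _ ⟨e, _, rfl⟩
    simp [edgeVec]
  · intro f hf
    have hf' : f.sum (fun _ a => a) = 0 := by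
      simpa [Finsupp.linearCombination_apply] using hf
    have : f = f.sum (fun v a => a • (Finsupp.single v 1 - Finsupp.single r 1 : W →₀ ℚ)) := by
      simp only [smul_sub, Finsupp.smul_single, smul_eq_mul, mul_one, Finsupp.sum_sub,
        Finsupp.sum_single]
      have h0 : (f.sum fun _ => Finsupp.single r) = 0 := by
        have h1 := map_finsuppSum (Finsupp.singleAddHom r) f (fun _ a => a)
        rw [hf', map_zero] at h1
        exact h1.symm
      rw [h0, sub_zero]
    rw [this]
    refine Submodule.sum_mem _ fun v _ => Submodule.smul_mem _ _ ?_
    exact (single_sub_single_mem_span_iff X Y I v r).2 (h v).symm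

/-- Edge vectors lie in the hyperplane of coordinate sum zero; its dimension is the size of a
spanning tree. -/
theorem finrank_ker_sum [Fintype W] (r : W) :
    Module.finrank ℚ (LinearMap.ker (Finsupp.linearCombination ℚ (fun _ : W => (1 : ℚ)))) + 1 =
      Fintype.card W := by
  have h := LinearMap.finrank_range_add_finrank_ker
    (Finsupp.linearCombination ℚ (fun _ : W => (1 : ℚ)))
  have hr : LinearMap.range (Finsupp.linearCombination ℚ (fun _ : W => (1 : ℚ))) = ⊤ := by
    rw [LinearMap.range_eq_top]
    intro x
    exact ⟨Finsupp.single r x, by simp⟩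
  rw [hr, finrank_top, Module.finrank_self, Module.finrank_finsupp_self] at h
  omega

/-- With one edge less than nodes, a graph is a forest if and only if it is connected. -/
theorem linearIndepOn_edgeVec_iff_conn [Fintype W] {X Y : E → W} {B : Finset E} (r : W)
    (hB : B.card + 1 = Fintype.card W) :
    LinearIndepOn ℚ (edgeVec X Y) (B : Set E) ↔ ∀ v, Conn X Y B r v := by
  have hk := finrank_ker_sum r
  have hr : Submodule.span ℚ (edgeVec X Y '' (B : Set E)) =
      Submodule.span ℚ (Set.range fun i : B => edgeVec X Y i) := by
    rw [Set.image_eq_range]; rfl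
  constructor
  · intro h v
    rw [← single_sub_single_mem_span_iff]
    have h1 := finrank_span_eq_card (R := ℚ) (b := fun i : B => edgeVec X Y i) h
    have h2 : Submodule.span ℚ (edgeVec X Y '' (B : Set E)) ≤
        LinearMap.ker (Finsupp.linearCombination ℚ (fun _ : W => (1 : ℚ))) := by
      rw [Submodule.span_le]
      rintro _ ⟨e, _, rfl⟩
      simp [edgeVec]
    have h3 := Submodule.eq_of_le_of_finrank_eq h2 (by
      rw [hr, h1, Fintype.card_coe]; omega)
    rw [h3]
    simp
  · intro h
    have h1 := span_edgeVec_eq_ker r h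
    rw [hr] at h1
    refine linearIndependent_iff_card_eq_finrank_span.2 ?_
    have h2 : Fintype.card (B : Set E) = B.card := by simp
    rw [Set.finrank, h2]
    change _ = Module.finrank ℚ (Submodule.span ℚ (Set.range fun i : B => edgeVec X Y i))
    rw [h1]; omega

end Linear

/-! ### Arborescences, reachability and connectivity -/

theorem exists_exit_of_reflTransGen {α : Type*} {R : α → α → Prop} {u v : α}
    (h : Relation.ReflTransGen R u v) {p : α → Prop} (hu : p u) (hv : ¬ p v) :
    ∃ x y, R x y ∧ p x ∧ ¬ p y := by
  induction h with
  | refl => exact absurd hu hv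
  | @tail b c _ hbc ih =>
    by_cases hb : p b
    · exact ⟨b, c, hbc, hb, hv⟩
    · exact ih hb

theorem Conn.mono {E W : Type*} {X Y : E → W} {I J : Set E} (h : I ⊆ J) {u v : W}
    (hc : Conn X Y I u v) : Conn X Y J u v :=
  Relation.EqvGen.mono (r := fun u v => ∃ e ∈ I, X e = u ∧ Y e = v)
    (fun _ _ ⟨e, he, h1⟩ => ⟨e, h he, h1⟩) _ _ hc

section Arborescence

variable {V A : Type*} {D : MultiDigraph V A} {r : V}

/-- The arc `a` enters the node set `Z`. -/
abbrev MultiDigraph.Enters (D : MultiDigraph V A) (a : A) (Z : Finset V) : Prop :=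
  D.tail a ∉ Z ∧ D.head a ∈ Z

/-- An arc of `B` leads from `u` to `v`. -/
def MultiDigraph.Arc (D : MultiDigraph V A) (B : Set A) (u v : V) : Prop :=
  ∃ a ∈ B, D.tail a = u ∧ D.head a = v

/-- A directed path in `B` leads from `u` to `v`. -/
def MultiDigraph.Reach (D : MultiDigraph V A) (B : Set A) : V → V → Prop :=
  Relation.ReflTransGen (D.Arc B)

/-- No arc of `B` enters `r`, exactly one arc of `B` enters each other node. -/
def MultiDigraph.InDegOne (D : MultiDigraph V A) (r : V) (B : Finset A) : Prop :=
  (∀ a ∈ B, D.head a ≠ r) ∧ ∀ v, v ≠ r → ∃! a, a ∈ B ∧ D.head a = v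

theorem MultiDigraph.InDegOne.head_injOn {B : Finset A} (h : D.InDegOne r B) {a b : A}
    (ha : a ∈ B) (hb : b ∈ B) (hab : D.head a = D.head b) : a = b :=
  (h.2 _ (h.1 a ha)).unique ⟨ha, rfl⟩ ⟨hb, hab.symm⟩

theorem MultiDigraph.InDegOne.card_add_one [Fintype V] {B : Finset A} (h : D.InDegOne r B) :
    B.card + 1 = Fintype.card V := by
  classical
  have h1 : B.image D.head = Finset.univ.erase r := by
    ext v
    simp only [Finset.mem_image, Finset.mem_erase, Finset.mem_univ, and_true]
    constructor
    · rintro ⟨a, ha, rfl⟩; exact h.1 a ha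
    · intro hv; obtain ⟨a, ha, -⟩ := h.2 v hv; exact ⟨a, ha.1, ha.2⟩
  rw [← Finset.card_image_of_injOn (f := D.head) (s := B)
    fun a ha b hb hab => h.head_injOn ha hb hab, h1,
    Finset.card_erase_add_one (Finset.mem_univ r), Finset.card_univ]

/-- The in-degree condition fixes the number of arcs at one less than the number of nodes, so
acyclicity can be traded for connectivity. -/
theorem MultiDigraph.isArborescence_iff [Fintype V] {B : Finset A} :
    D.IsArborescence r B ↔ D.InDegOne r B ∧ ∀ v, Conn D.tail D.head B r v := by
  rw [MultiDigraph.IsArborescence, ← and_assoc]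
  refine and_congr_right fun h => ?_
  rw [containsCycle_iff_not_linearIndepOn_edgeVec (X := D.tail) (Y := D.head) (S := Set.univ)
    (fun a x y => by simp [MultiDigraph.toGraph]) (Set.subset_univ _), not_not]
  exact linearIndepOn_edgeVec_iff_conn r (MultiDigraph.InDegOne.card_add_one h)

/-- Reachability from `r` also passes backwards along an arc: a directed path to its head must end
with this very arc, the only one of `B` entering there. Hence it is constant on components. -/
theorem MultiDigraph.InDegOne.reach {B : Finset A} (h : D.InDegOne r B)
    (hc : ∀ v, Conn D.tail D.head B r v) (v : V) : D.Reach B r v := by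
  have key : ∀ u v, Conn D.tail D.head B u v → (D.Reach B r u ↔ D.Reach B r v) := by
    intro u v huv
    induction huv with
    | rel x y hxy =>
      obtain ⟨a, ha, rfl, rfl⟩ := hxy
      constructor
      · exact fun h1 => h1.tail ⟨a, ha, rfl, rfl⟩
      · intro h1
        rcases Relation.ReflTransGen.cases_tail h1 with h2 | ⟨w, h2, b, hb, h3, h4⟩
        · exact absurd h2 (h.1 a ha)
        · rw [← h.head_injOn hb ha h4, h3]; exact h2
    | refl => rfl
    | symm _ _ _ ih => exact ih.symm
    | trans _ _ _ _ _ ih1 ih2 => exact ih1.trans ih2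
  exact (key r v (hc v)).1 Relation.ReflTransGen.refl

theorem MultiDigraph.Reach.exists_enters {B : Set A} {u v : V} (h : D.Reach B u v)
    {Z : Finset V} (hu : u ∉ Z) (hv : v ∈ Z) : ∃ a ∈ B, D.Enters a Z := by
  obtain ⟨x, y, ⟨a, ha, rfl, rfl⟩, h1, h2⟩ :=
    exists_exit_of_reflTransGen h (p := fun w => w ∉ Z) hu (not_not.2 hv)
  exact ⟨a, ha, h1, not_not.1 h2⟩

/-- The edges of `B` with ends `X a`, `Y a` given by the arcs inside `S` connect `S`. -/
def MultiDigraph.ConnIn (D : MultiDigraph V A) (X Y : A → V) (B : Set A) (S : Finset V) : Prop :=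
  ∀ u ∈ S, ∀ v ∈ S, Conn X Y {a ∈ B | D.tail a ∈ S ∧ D.head a ∈ S} u v

/-- By the same backward argument inside `Z`, the nodes reachable from `head a` within `Z` fill its
component, so they include `head b`. A nontrivial path would end with an arc inside `Z` having head
`head b`, that is with `b` itself, whose tail is outside. -/
theorem MultiDigraph.InDegOne.enters_unique {B : Finset A} (h : D.InDegOne r B) {Z : Finset V}
    (hc : D.ConnIn D.tail D.head B Z) {a b : A} (ha : a ∈ B) (hb : b ∈ B)
    (haZ : D.Enters a Z) (hbZ : D.Enters b Z) : a = b := by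
  let R : V → V → Prop := D.Arc {e ∈ (B : Set A) | D.tail e ∈ Z ∧ D.head e ∈ Z}
  have key : ∀ u v, Conn D.tail D.head {e ∈ (B : Set A) | D.tail e ∈ Z ∧ D.head e ∈ Z} u v →
      (Relation.ReflTransGen R (D.head a) u ↔ Relation.ReflTransGen R (D.head a) v) := by
    intro u v huv
    induction huv with
    | rel x y hxy =>
      obtain ⟨e, he, rfl, rfl⟩ := hxy
      constructor
      · exact fun h1 => h1.tail ⟨e, he, rfl, rfl⟩
      · intro h1
        rcases Relation.ReflTransGen.cases_tail h1 with h2 | ⟨w, h2, f, hf, h3, h4⟩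
        · exact absurd (h.head_injOn he.1 ha h2 ▸ he.2.1) haZ.1
        · rw [← h.head_injOn hf.1 he.1 h4, h3]; exact h2
    | refl => rfl
    | symm _ _ _ ih => exact ih.symm
    | trans _ _ _ _ _ ih1 ih2 => exact ih1.trans ih2
  rcases Relation.ReflTransGen.cases_tail
    ((key _ _ (hc _ haZ.2 _ hbZ.2)).1 Relation.ReflTransGen.refl) with h2 | ⟨w, -, f, hf, -, h4⟩
  · exact (h.head_injOn hb ha h2).symm
  · exact absurd (h.head_injOn hf.1 hb h4 ▸ hf.2.1) hbZ.1

/-- A path from `r` to a node of `Z` enters `Z` for the last time through the unique entering arc,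
and from its head on it stays in `Z`. -/
theorem MultiDigraph.connIn_of_enters_unique {B : Set A} {Z : Finset V} (hr : r ∉ Z)
    (hreach : ∀ v, D.Reach B r v)
    (hu : ∀ a ∈ B, ∀ b ∈ B, D.Enters a Z → D.Enters b Z → a = b) :
    D.ConnIn D.tail D.head B Z := by
  have key : ∀ u v, D.Reach B r u → D.Reach B r v → u ∈ Z → v ∈ Z →
      Conn D.tail D.head {a ∈ B | D.tail a ∈ Z ∧ D.head a ∈ Z} u v := by
    intro u v hu' hv'
    obtain ⟨a, ha, haZ⟩ | hno : (∃ a ∈ B, D.Enters a Z) ∨ ¬ ∃ a ∈ B, D.Enters a Z := em _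
    · have h1 : ∀ w, D.Reach B r w → w ∈ Z →
          Conn D.tail D.head {a ∈ B | D.tail a ∈ Z ∧ D.head a ∈ Z} (D.head a) w := by
        intro w hw
        induction hw with
        | refl => exact fun h => absurd h hr
        | tail _ hbc ih =>
          obtain ⟨b, hb, rfl, rfl⟩ := hbc
          intro hhead
          by_cases ht : D.tail b ∈ Z
          · exact (ih ht).trans _ _ _ (Relation.EqvGen.rel _ _ ⟨b, ⟨hb, ht, hhead⟩, rfl, rfl⟩)
          · rw [hu b hb a ha ⟨ht, hhead⟩ haZ]; exact Relation.EqvGen.refl _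
      exact fun huZ hvZ => (h1 u hu' huZ).symm.trans _ _ _ (h1 v hv' hvZ)
    · exact fun huZ => absurd (hu'.exists_enters hr huZ) hno
  exact fun u hu v hv => key u v (hreach u) (hreach v) hu hv

/-- Connectivity inside the members of a family is inherited by a second way to place the edges,
if the two places of each end lie in a common smaller member. -/
theorem MultiDigraph.connIn_transfer {F : Set (Finset V)} {X Y X' Y' : A → V} {B : Set A}
    (hF : ∀ S ∈ F, ∀ a ∈ B, D.tail a ∈ S → D.head a ∈ S → ∃ C₁ ∈ F, ∃ C₂ ∈ F, C₁ ⊂ S ∧ C₂ ⊂ S ∧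
      (X a ∈ C₁ ∧ X' a ∈ C₁) ∧ (Y a ∈ C₂ ∧ Y' a ∈ C₂))
    (h : ∀ S ∈ F, D.ConnIn X Y B S) : ∀ S ∈ F, D.ConnIn X' Y' B S := by
  intro S
  induction S using Finset.strongInduction with
  | H S ih =>
    intro hS u hu v hv
    have hsub : ∀ C ⊆ S, {a ∈ B | D.tail a ∈ C ∧ D.head a ∈ C} ⊆
        {a ∈ B | D.tail a ∈ S ∧ D.head a ∈ S} :=
      fun C hC a ha => ⟨ha.1, hC ha.2.1, hC ha.2.2⟩
    have key : ∀ u v, Conn X Y {a ∈ B | D.tail a ∈ S ∧ D.head a ∈ S} u v →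
        Conn X' Y' {a ∈ B | D.tail a ∈ S ∧ D.head a ∈ S} u v := by
      intro u v huv
      induction huv with
      | rel x y hxy =>
        obtain ⟨a, ha, rfl, rfl⟩ := hxy
        obtain ⟨C₁, h1, C₂, h2, h3, h4, ⟨h5, h6⟩, ⟨h7, h8⟩⟩ := hF S hS a ha.1 ha.2.1 ha.2.2
        -- By induction the old and new place of each end are already joined inside the smaller
        -- member, so the detour old end, new end, arc, new end, old end is available.
        have e1 := (ih C₁ h3 h1 _ h5 _ h6).mono (hsub _ h3.1)
        have e2 := (ih C₂ h4 h2 _ h8 _ h7).mono (hsub _ h4.1)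
        exact (e1.trans _ _ _ (Relation.EqvGen.rel _ _ ⟨a, ha, rfl, rfl⟩)).trans _ _ _ e2
      | refl => exact Relation.EqvGen.refl _
      | symm _ _ _ ih => exact ih.symm
      | trans _ _ _ _ _ ih1 ih2 => exact ih1.trans _ _ _ ih2
    exact key u v (h S hS u hu v hv)

theorem MultiDigraph.IsArborescence.tail_ne_head {B : Finset A} (hB : D.IsArborescence r B) {a : A}
    (ha : a ∈ B) : D.tail a ≠ D.head a := by
  intro he
  refine hB.2.2 ⟨1, fun _ => D.head a, fun _ => a, one_pos, rfl, ?_, ?_,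
    fun i _ => ⟨ha, Or.inl ⟨he, rfl⟩⟩⟩
  · intro i hi j hj _
    rw [Set.mem_Iio] at hi hj; omega
  · intro i hi j hj _
    rw [Set.mem_Iio] at hi hj; omega

end Arborescence

/-! ### Dual solutions -/

section Stage

variable {V A : Type*} [LinearOrder V]

/-- The state of the primal-dual method after `k` rounds: round `i` raised the dual variable of
`Z i` by `δ i`, the arc `a` was marked in round `τ a`, `red` are the reduced costs, and `rep u v` is
the least node of the largest set that contains `u` and not `v`. -/
structure Stage (D : MultiDigraph V A) (r : V) (c : A → ℝ) (k : ℕ) (Z : ℕ → Finset V) (δ : ℕ → ℝ)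
    (τ : A → ℕ) (red : A → ℝ) (mark : Set A) (rep : V → V → V) : Prop where
  root_notMem : ∀ i < k, r ∉ Z i
  nonempty : ∀ i < k, (Z i).Nonempty
  laminar : ∀ j < k, ∀ i < j, Z i ⊆ Z j ∨ Disjoint (Z i) (Z j)
  -- Together with `strong` this orders the marks in time: the arcs connecting `Z i` are marked
  -- before round `i`, the arcs entering it not before.
  le_of_enters : ∀ a ∈ mark, ∀ i < k, D.Enters a (Z i) → i ≤ τ a
  lt_of_mark : ∀ a ∈ mark, τ a < k
  strong : ∀ i < k, ∀ u ∈ Z i, ∀ v ∈ Z i, Relation.ReflTransGen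
    (fun x y => ∃ a ∈ mark, τ a < i ∧ D.tail a = x ∧ D.head a = y ∧ x ∈ Z i ∧ y ∈ Z i) u v
  exists_enters : ∀ a ∈ mark, ∃ i < k, D.Enters a (Z i)
  red_eq : ∀ a, red a = c a - ∑ i ∈ Finset.range k, if D.Enters a (Z i) then δ i else 0
  -- Arcs into nodes lying in no raised set may still have negative reduced cost, as `c` has no
  -- sign. Loops are never lowered, so they are excluded for good.
  touched : ∀ a, ∀ i < k, D.head a ∈ Z i → D.tail a ≠ D.head a →
    0 ≤ red a ∧ (red a = 0 ↔ a ∈ mark)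
  pos : ∀ i < k, ∀ u ∈ Z i, ∀ v ∈ Z i, u ≠ v → 0 < δ i
  rep_spec : ∀ u v, u ≠ v → ∃ C : Finset V, u ∈ C ∧ v ∉ C ∧ IsLeast (C : Set V) (rep u v) ∧
    (C = {u} ∨ ∃ i < k, C = Z i) ∧ ∀ i < k, u ∈ Z i → v ∉ Z i → Z i ⊆ C

variable {D : MultiDigraph V A} {r : V} {c : A → ℝ} {k : ℕ} {Z : ℕ → Finset V} {δ : ℕ → ℝ}
  {τ : A → ℕ} {red : A → ℝ} {mark : Set A} {rep : V → V → V}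

namespace Stage

theorem head_ne_root (h : Stage D r c k Z δ τ red mark rep) {a : A} (ha : a ∈ mark) :
    D.head a ≠ r := by
  obtain ⟨i, hi, h1⟩ := h.exists_enters a ha
  intro h2
  exact h.root_notMem i hi (h2 ▸ h1.2)

theorem tail_ne_head (h : Stage D r c k Z δ τ red mark rep) {a : A} (ha : a ∈ mark) :
    D.tail a ≠ D.head a := by
  obtain ⟨i, hi, h1⟩ := h.exists_enters a ha
  intro h2
  exact h1.1 (h2 ▸ h1.2)

theorem exists_mem_of_arc (h : Stage D r c k Z δ τ red mark rep) {a : A} (ha : a ∈ mark) :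
    ∃ i < k, D.head a ∈ Z i :=
  (h.exists_enters a ha).imp fun _ h1 => ⟨h1.1, h1.2.2⟩

theorem subset_or_subset_or_disjoint (h : Stage D r c k Z δ τ red mark rep) {i j : ℕ}
    (hi : i < k) (hj : j < k) : Z i ⊆ Z j ∨ Z j ⊆ Z i ∨ Disjoint (Z i) (Z j) := by
  rcases lt_trichotomy i j with hij | rfl | hij
  · rcases h.laminar j hj i hij with h1 | h1
    · exact Or.inl h1
    · exact Or.inr (Or.inr h1)
  · exact Or.inl subset_rfl
  · rcases h.laminar i hi j hij with h1 | h1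
    · exact Or.inr (Or.inl h1)
    · exact Or.inr (Or.inr h1.symm)

/-- Moving an end of an arc inside `Z i` to its representative keeps it within a proper submember of
`Z i`; this feeds the induction in `connIn_transfer`. -/
theorem exists_rep_mem_ssubset (h : Stage D r c k Z δ τ red mark rep) {i : ℕ} (hi : i < k) {u v : V}
    (huv : u ≠ v) (hu : u ∈ Z i) (hv : v ∈ Z i) :
    ∃ C : Finset V, (C = {u} ∨ ∃ j < k, C = Z j) ∧ C ⊂ Z i ∧ u ∈ C ∧ rep u v ∈ C := by
  obtain ⟨C, h1, h2, h3, h4, -⟩ := h.rep_spec u v huv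
  refine ⟨C, h4, ?_, h1, h3.1⟩
  refine Finset.ssubset_iff_subset_ne.2 ⟨?_, fun he => h2 (he ▸ hv)⟩
  rcases h4 with rfl | ⟨j, hj, rfl⟩
  · simpa using hu
  · rcases h.subset_or_subset_or_disjoint hi hj with h5 | h5 | h5
    · exact absurd (h5 hv) h2
    · exact h5
    · exact absurd h1 (Finset.disjoint_left.1 h5 hu)

/-- This is the gluing property. The maximal set `C` represented by `rep u v` meets `Z i`, and
laminarity with maximality forces `Z i ⊆ C`; thus the least node of `C`, being in `Z i`, is the
least node of `Z i`. -/
theorem rep_eq_of_mem (h : Stage D r c k Z δ τ red mark rep) {i : ℕ} (hi : i < k) {u v ρ : V}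
    (huv : u ≠ v) (hn : ¬ (u ∈ Z i ∧ v ∈ Z i)) (hρ : IsLeast (Z i : Set V) ρ)
    (hm : rep u v ∈ Z i) : rep u v = ρ := by
  obtain ⟨C, h1, h2, h3, h4, h5⟩ := h.rep_spec u v huv
  have hsub : Z i ⊆ C := by
    have hCZ : C ⊆ Z i → Z i ⊆ C := fun h6 => h5 i hi (h6 h1) fun h7 => hn ⟨h6 h1, h7⟩
    rcases h4 with rfl | ⟨j, hj, rfl⟩
    · have : rep u v = u := by simpa using h3.1
      exact hCZ (by rw [this] at hm; simpa using hm)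
    · rcases h.subset_or_subset_or_disjoint hi hj with h6 | h6 | h6
      · exact h6
      · exact hCZ h6
      · exact absurd h3.1 (Finset.disjoint_left.1 h6 hm)
  exact le_antisymm (h3.2 (hsub hρ.1)) (hρ.2 hm)

/-- `B` is an arborescence of marked arcs that enters each of the sets `Z i` exactly once. -/
def Tight (D : MultiDigraph V A) (r : V) (k : ℕ) (Z : ℕ → Finset V) (mark : Set A)
    (B : Finset A) : Prop :=
  D.IsArborescence r B ∧ (B : Set A) ⊆ mark ∧
    ∀ i < k, (B.filter fun a => D.Enters a (Z i)).card = 1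

theorem enters_unique_of_tight {B : Finset A} (hB : Tight D r k Z mark B) {i : ℕ} (hi : i < k)
    {a b : A} (ha : a ∈ B) (hb : b ∈ B) (haZ : D.Enters a (Z i)) (hbZ : D.Enters b (Z i)) :
    a = b :=
  Finset.card_le_one.1 (hB.2.2 i hi).le a (by simpa [ha] using haZ) b (by simpa [hb] using hbZ)

theorem one_le_card_enters {B : Finset A} (hB : ∀ v, D.Reach B r v) {Z : Finset V} (hr : r ∉ Z)
    (hZ : Z.Nonempty) : 1 ≤ (B.filter fun a => D.Enters a Z).card := by
  obtain ⟨v, hv⟩ := hZ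
  obtain ⟨a, ha, haZ⟩ := (hB v).exists_enters hr hv
  exact Finset.card_pos.2 ⟨a, Finset.mem_filter.2 ⟨ha, haZ⟩⟩

variable [Fintype V]

/-- Given in-degree one, connectivity inside `Z i` is equivalent to a single entrance, and
connectivity on all nodes to being an arborescence. Singletons cost nothing and are included because
`rep` may stand for one. -/
theorem tight_iff_connIn (h : Stage D r c k Z δ τ red mark rep) (B : Finset A) :
    Tight D r k Z mark B ↔ (B : Set A) ⊆ mark ∧ D.InDegOne r B ∧
      ∀ S ∈ {S | S = Finset.univ ∨ (∃ i < k, S = Z i) ∨ ∃ u, S = {u}},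
        D.ConnIn D.tail D.head B S := by
  constructor
  · intro hB
    obtain ⟨h1, h2⟩ := D.isArborescence_iff.1 hB.1
    refine ⟨hB.2.1, h1, ?_⟩
    rintro S (rfl | ⟨i, hi, rfl⟩ | ⟨w, rfl⟩)
    · intro u _ v _
      have := (h2 u).symm.trans _ _ _ (h2 v)
      exact this.mono (by simp)
    · exact D.connIn_of_enters_unique (h.root_notMem i hi) (h1.reach h2)
        fun a ha b hb => enters_unique_of_tight hB hi ha hb
    · intro u hu v hv
      rw [Finset.mem_singleton.1 hu, Finset.mem_singleton.1 hv]
      exact Relation.EqvGen.refl _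
  · rintro ⟨h1, h2, h3⟩
    have h4 : ∀ v, Conn D.tail D.head B r v := fun v =>
      (h3 Finset.univ (Or.inl rfl) r (Finset.mem_univ _) v (Finset.mem_univ _)).mono
        fun a ha => ha.1
    refine ⟨D.isArborescence_iff.2 ⟨h2, h4⟩, h1, fun i hi => le_antisymm ?_ ?_⟩
    · rw [Finset.card_le_one]
      intro a ha b hb
      rw [Finset.mem_filter] at ha hb
      exact h2.enters_unique (h3 (Z i) (Or.inr (Or.inl ⟨i, hi, rfl⟩))) ha.1 hb.1 ha.2 hb.2
    · exact one_le_card_enters (h2.reach h4) (h.root_notMem i hi) (h.nonempty i hi)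

/-- The tight arborescences are the spanning trees of the output graph that enter each node other
than the root once. -/
theorem tight_iff (h : Stage D r c k Z δ τ red mark rep) (B : Finset A) :
    Tight D r k Z mark B ↔ (B : Set A) ⊆ mark ∧ D.InDegOne r B ∧
      ∀ v, Conn (fun a => rep (D.tail a) (D.head a)) (fun a => rep (D.head a) (D.tail a)) B r v := by
  rw [h.tight_iff_connIn B]
  refine and_congr_right fun hBm => and_congr_right fun hdeg => ?_
  set X : A → V := fun a => rep (D.tail a) (D.head a) with hX
  set Y : A → V := fun a => rep (D.head a) (D.tail a) with hY
  set F : Set (Finset V) := {S | S = Finset.univ ∨ (∃ i < k, S = Z i) ∨ ∃ u, S = {u}} with hFdef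
  have hCF : ∀ (C : Finset V) (u : V), (C = {u} ∨ ∃ j < k, C = Z j) → C ∈ F := by
    rintro C u (rfl | h1)
    · exact Or.inr (Or.inr ⟨u, rfl⟩)
    · exact Or.inr (Or.inl h1)
  have hF : ∀ S ∈ F, ∀ a ∈ (B : Set A), D.tail a ∈ S → D.head a ∈ S → ∃ C₁ ∈ F, ∃ C₂ ∈ F,
      C₁ ⊂ S ∧ C₂ ⊂ S ∧ (D.tail a ∈ C₁ ∧ X a ∈ C₁) ∧ (D.head a ∈ C₂ ∧ Y a ∈ C₂) := by
    intro S hS a ha ht hh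
    have hne := h.tail_ne_head (hBm ha)
    rcases hS with rfl | ⟨i, hi, rfl⟩ | ⟨w, rfl⟩
    · obtain ⟨C₁, h1, h2, h3, h4, -⟩ := h.rep_spec _ _ hne
      obtain ⟨C₂, h1', h2', h3', h4', -⟩ := h.rep_spec _ _ hne.symm
      exact ⟨C₁, hCF _ _ h4, C₂, hCF _ _ h4',
        Finset.ssubset_univ_iff.2 fun he => h2 (he ▸ Finset.mem_univ _),
        Finset.ssubset_univ_iff.2 fun he => h2' (he ▸ Finset.mem_univ _), ⟨h1, h3.1⟩, h1', h3'.1⟩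
    · obtain ⟨C₁, h1, h2, h3⟩ := h.exists_rep_mem_ssubset hi hne ht hh
      obtain ⟨C₂, h1', h2', h3'⟩ := h.exists_rep_mem_ssubset hi hne.symm hh ht
      exact ⟨C₁, hCF _ _ h1, C₂, hCF _ _ h1', h2, h2', h3, h3'⟩
    · exact absurd ((Finset.mem_singleton.1 ht).trans (Finset.mem_singleton.1 hh).symm) hne
  have hF' : ∀ S ∈ F, ∀ a ∈ (B : Set A), D.tail a ∈ S → D.head a ∈ S → ∃ C₁ ∈ F, ∃ C₂ ∈ F,
      C₁ ⊂ S ∧ C₂ ⊂ S ∧ (X a ∈ C₁ ∧ D.tail a ∈ C₁) ∧ (Y a ∈ C₂ ∧ D.head a ∈ C₂) := by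
    intro S hS a ha ht hh
    obtain ⟨C₁, h1, C₂, h2, h3, h4, h5, h6⟩ := hF S hS a ha ht hh
    exact ⟨C₁, h1, C₂, h2, h3, h4, h5.symm, h6.symm⟩
  constructor
  · intro h1 v
    have h2 := D.connIn_transfer hF h1
    exact (h2 Finset.univ (Or.inl rfl) r (Finset.mem_univ _) v (Finset.mem_univ _)).mono
      fun a ha => ha.1
  · intro h1
    refine D.connIn_transfer hF' ?_
    rintro S (rfl | ⟨i, hi, rfl⟩ | ⟨w, rfl⟩)
    · intro u _ v _
      exact ((h1 u).symm.trans _ _ _ (h1 v)).mono (by simp)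
    · have hρ := (Z i).isLeast_min' (h.nonempty i hi)
      set ρ := (Z i).min' (h.nonempty i hi)
      -- Retract all nodes onto `Z i`, sending the outside to `ρ`. Arcs inside `Z i` are kept and by
      -- `rep_eq_of_mem` all others collapse to the point `ρ`, so a connection in the whole glued
      -- graph becomes one inside `Z i`.
      have key : ∀ u v, Conn X Y B u v →
          Conn X Y {a ∈ (B : Set A) | D.tail a ∈ Z i ∧ D.head a ∈ Z i}
            (if u ∈ Z i then u else ρ) (if v ∈ Z i then v else ρ) := by
        intro u v huv
        induction huv with
        | rel x y hxy =>
          obtain ⟨a, ha, rfl, rfl⟩ := hxy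
          have hne := h.tail_ne_head (hBm ha)
          by_cases hin : D.tail a ∈ Z i ∧ D.head a ∈ Z i
          · obtain ⟨C₁, -, C₂, -, h3, h4, h5, h6⟩ :=
              hF (Z i) (Or.inr (Or.inl ⟨i, hi, rfl⟩)) a ha hin.1 hin.2
            rw [if_pos (h3.1 h5.2), if_pos (h4.1 h6.2)]
            exact Relation.EqvGen.rel _ _ ⟨a, ⟨ha, hin⟩, rfl, rfl⟩
          · have e1 : (if X a ∈ Z i then X a else ρ) = ρ := by
              split_ifs with h3
              · exact h.rep_eq_of_mem hi hne hin hρ h3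
              · rfl
            have e2 : (if Y a ∈ Z i then Y a else ρ) = ρ := by
              split_ifs with h3
              · exact h.rep_eq_of_mem hi hne.symm (fun h4 => hin h4.symm) hρ h3
              · rfl
            rw [e1, e2]
            exact Relation.EqvGen.refl _
        | refl => exact Relation.EqvGen.refl _
        | symm _ _ _ ih => exact ih.symm
        | trans _ _ _ _ _ ih1 ih2 => exact ih1.trans _ _ _ ih2
      intro u hu v hv
      have := key u v ((h1 u).symm.trans _ _ _ (h1 v))
      rwa [if_pos hu, if_pos hv] at this
    · intro u hu v hv
      rw [Finset.mem_singleton.1 hu, Finset.mem_singleton.1 hv]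
      exact Relation.EqvGen.refl _

end Stage

end Stage

/-! ### Complementary slackness and optimality -/

section Optimality

variable {V A : Type*} [LinearOrder V]
variable {D : MultiDigraph V A} {r : V} {c : A → ℝ} {k : ℕ} {Z : ℕ → Finset V} {δ : ℕ → ℝ}
  {τ : A → ℕ} {red : A → ℝ} {mark : Set A} {rep : V → V → V}

namespace Stage

/-- Split each cost into its reduced cost and the dual variables it pays for, then exchange the
sums. What exceeds the dual value is the reduced cost of `B` plus the weighted surplus of entrances.
-/
theorem cost_eq (h : Stage D r c k Z δ τ red mark rep) (B : Finset A) :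
    ∑ a ∈ B, c a = ∑ i ∈ Finset.range k, δ i + (∑ a ∈ B, red a + ∑ i ∈ Finset.range k,
      δ i * (((B.filter fun a => D.Enters a (Z i)).card : ℝ) - 1)) := by
  have h1 : ∀ a, c a = red a + ∑ i ∈ Finset.range k, if D.Enters a (Z i) then δ i else 0 := by
    intro a; rw [h.red_eq a]; ring
  have h2 : ∀ i, δ i * (((B.filter fun a => D.Enters a (Z i)).card : ℝ) - 1) =
      (∑ a ∈ B, if D.Enters a (Z i) then δ i else 0) - δ i := by
    intro i
    rw [← Finset.sum_filter, Finset.sum_const, nsmul_eq_mul]; ring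
  rw [Finset.sum_congr rfl fun a _ => h1 a, Finset.sum_add_distrib, Finset.sum_comm,
    Finset.sum_congr rfl fun i _ => h2 i, Finset.sum_sub_distrib]
  ring

/-- Once everything is reached from `r`, each other node is the head of a marked arc and so lies in
a raised set; arborescences contain no loops. Hence `touched` applies. -/
theorem red_nonneg_of_isArborescence (h : Stage D r c k Z δ τ red mark rep)
    (hreach : ∀ v, D.Reach mark r v) {B : Finset A} (hB : D.IsArborescence r B) {a : A}
    (ha : a ∈ B) : 0 ≤ red a ∧ (red a = 0 ↔ a ∈ mark) := by
  rcases Relation.ReflTransGen.cases_tail (hreach (D.head a)) with h1 | ⟨w, -, b, hb, -, h2⟩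
  · exact absurd h1 (hB.1 a ha)
  · obtain ⟨i, hi, h3⟩ := h.exists_mem_of_arc hb
    exact h.touched a i hi (h2 ▸ h3) (hB.tail_ne_head ha)

variable [Fintype V]

/-- Grow a tree from `r`, always adding the marked arc that leaves the reached set `R` and was
marked earliest. This order keeps each `Z i` from being entered twice. -/
theorem exists_tight [Fintype A] (h : Stage D r c k Z δ τ red mark rep)
    (hreach : ∀ v, D.Reach mark r v) : ∃ B, Tight D r k Z mark B := by
  classical
  have key : ∀ s, s + 1 ≤ Fintype.card V → ∃ (R : Finset V) (B : Finset A), r ∈ R ∧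
      R.card = s + 1 ∧ (B : Set A) ⊆ mark ∧ (∀ a ∈ B, D.tail a ∈ R ∧ D.head a ∈ R) ∧
      (∀ v ∈ R, v ≠ r → ∃! a, a ∈ B ∧ D.head a = v) ∧
      (∀ v ∈ R, Conn D.tail D.head B r v) ∧
      ∀ i < k, ∀ a ∈ B, ∀ b ∈ B, D.Enters a (Z i) → D.Enters b (Z i) → a = b := by
    intro s
    induction s with
    | zero =>
      intro _
      refine ⟨{r}, ∅, by simp, by simp, by simp, by simp, ?_, ?_, by simp⟩
      · intro v hv hvr; exact absurd (Finset.mem_singleton.1 hv) hvr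
      · intro v hv; rw [Finset.mem_singleton.1 hv]; exact Relation.EqvGen.refl _
    | succ s ih =>
      intro hs
      obtain ⟨R, B, hrR, hcard, hBm, hBR, hdeg, hconn, huniq⟩ := ih (by omega)
      have hex : ∃ v, v ∉ R := by
        by_contra hcon
        push Not at hcon
        rw [Finset.eq_univ_iff_forall.2 hcon, Finset.card_univ] at hcard
        omega
      obtain ⟨w, hw⟩ := hex
      obtain ⟨a₀, ha₀, ha₀R⟩ := (hreach w).exists_enters (Z := Rᶜ) (by simpa using hrR)
        (by simpa using hw)
      obtain ⟨a, haL, hmin⟩ := Finset.exists_min_image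
        (Finset.univ.filter fun a => a ∈ mark ∧ D.Enters a Rᶜ) τ
        ⟨a₀, Finset.mem_filter.2 ⟨Finset.mem_univ _, ha₀, ha₀R⟩⟩
      obtain ⟨-, ham, hat, hah⟩ := Finset.mem_filter.1 haL
      simp only [Finset.mem_compl, not_not] at hat hah
      have hheadB : ∀ b ∈ B, D.head b ≠ D.head a := fun b hb he => hah (he ▸ (hBR b hb).2)
      -- If `b` has already entered `Z i` and `a` enters it now, a path from `head b` to `head a` of
      -- arcs marked before round `i` leaves `R` through some arc `f`. Minimality gives `τ a ≤ τ f <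
      -- i`, but an arc entering `Z i` has `i ≤ τ a`.
      have hnew : ∀ i < k, ∀ b ∈ B, D.Enters b (Z i) → ¬ D.Enters a (Z i) := by
        intro i hi b hb hbZ haZ
        obtain ⟨x, y, ⟨f, hf, hfi, hx, hy, -⟩, hxR, hyR⟩ := exists_exit_of_reflTransGen
          (h.strong i hi _ hbZ.2 _ haZ.2) (p := fun v => v ∈ R) (hBR b hb).2 hah
        have h1 := hmin f (Finset.mem_filter.2 ⟨Finset.mem_univ _, hf, by
          rw [hx]; simpa using hxR, by rw [hy]; simpa using hyR⟩)
        have h2 := h.le_of_enters a ham i hi haZ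
        omega
      refine ⟨insert (D.head a) R, insert a B, Finset.mem_insert_of_mem hrR, ?_, ?_, ?_, ?_, ?_, ?_⟩
      · rw [Finset.card_insert_of_notMem hah, hcard]
      · rw [Finset.coe_insert]; exact Set.insert_subset ham hBm
      · intro b hb
        rcases Finset.mem_insert.1 hb with rfl | hb
        · exact ⟨Finset.mem_insert_of_mem hat, Finset.mem_insert_self _ _⟩
        · exact ⟨Finset.mem_insert_of_mem (hBR b hb).1, Finset.mem_insert_of_mem (hBR b hb).2⟩
      · intro v hv hvr
        rcases Finset.mem_insert.1 hv with rfl | hv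
        · refine ⟨a, ⟨Finset.mem_insert_self _ _, rfl⟩, fun b hb => ?_⟩
          rcases Finset.mem_insert.1 hb.1 with h1 | h1
          · exact h1
          · exact absurd hb.2 (hheadB b h1)
        · obtain ⟨b, hb, hb'⟩ := hdeg v hv hvr
          refine ⟨b, ⟨Finset.mem_insert_of_mem hb.1, hb.2⟩, fun f hf => ?_⟩
          rcases Finset.mem_insert.1 hf.1 with h1 | h1
          · exact absurd (hf.2 ▸ hv) (h1 ▸ hah)
          · exact hb' f ⟨h1, hf.2⟩
      · have hsub : (B : Set A) ⊆ (insert a B : Finset A) := by simp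
        intro v hv
        rcases Finset.mem_insert.1 hv with rfl | hv
        · exact ((hconn _ hat).mono hsub).trans _ _ _
            (Relation.EqvGen.rel _ _ ⟨a, by simp, rfl, rfl⟩)
        · exact (hconn v hv).mono hsub
      · intro i hi b hb f hf hbZ hfZ
        rcases Finset.mem_insert.1 hb with h1 | h1 <;> rcases Finset.mem_insert.1 hf with h2 | h2
        · rw [h1, h2]
        · exact absurd (h1 ▸ hbZ) (hnew i hi f h2 hfZ)
        · exact absurd (h2 ▸ hfZ) (hnew i hi b h1 hbZ)
        · exact huniq i hi b h1 f h2 hbZ hfZ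
  have hpos : 0 < Fintype.card V := Fintype.card_pos_iff.2 ⟨r⟩
  obtain ⟨R, B, -, hcard, hBm, -, hdeg, hconn, huniq⟩ := key (Fintype.card V - 1) (by omega)
  have hR : R = Finset.univ := (Finset.card_eq_iff_eq_univ R).1 (by omega)
  subst hR
  have hin : D.InDegOne r B := ⟨fun a ha => h.head_ne_root (hBm ha),
    fun v hv => hdeg v (Finset.mem_univ _) hv⟩
  have hc : ∀ v, Conn D.tail D.head B r v := fun v => hconn v (Finset.mem_univ _)
  refine ⟨B, D.isArborescence_iff.2 ⟨hin, hc⟩, hBm, fun i hi => le_antisymm ?_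
    (one_le_card_enters (hin.reach hc) (h.root_notMem i hi) (h.nonempty i hi))⟩
  rw [Finset.card_le_one]
  intro a ha b hb
  rw [Finset.mem_filter] at ha hb
  exact huniq i hi a ha.1 b hb.1 ha.2 hb.2

/-- With two nodes in `Z i` the dual variable is positive. On a singleton its sign is free, but the
in-degree condition makes the surplus vanish. -/
theorem excess_nonneg (h : Stage D r c k Z δ τ red mark rep) {B : Finset A}
    (hB : D.IsArborescence r B) {i : ℕ} (hi : i < k) :
    0 ≤ δ i * (((B.filter fun a => D.Enters a (Z i)).card : ℝ) - 1) ∧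
      (δ i * (((B.filter fun a => D.Enters a (Z i)).card : ℝ) - 1) = 0 ↔
        (B.filter fun a => D.Enters a (Z i)).card = 1) := by
  obtain ⟨h1, h2⟩ := D.isArborescence_iff.1 hB
  have hone := one_le_card_enters (h1.reach h2) (h.root_notMem i hi) (h.nonempty i hi)
  by_cases hsing : ∃ u ∈ Z i, ∃ v ∈ Z i, u ≠ v
  · obtain ⟨u, hu, v, hv, huv⟩ := hsing
    have hδ := h.pos i hi u hu v hv huv
    have hone' : (1 : ℝ) ≤ ((B.filter fun a => D.Enters a (Z i)).card : ℝ) := by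
      exact_mod_cast hone
    refine ⟨mul_nonneg hδ.le (by linarith), ?_⟩
    rw [mul_eq_zero, or_iff_right hδ.ne', sub_eq_zero]
    norm_cast
  · push Not at hsing
    have : (B.filter fun a => D.Enters a (Z i)).card = 1 := by
      refine le_antisymm (Finset.card_le_one.2 ?_) hone
      intro a ha b hb
      rw [Finset.mem_filter] at ha hb
      exact h1.head_injOn ha.1 hb.1 (hsing _ ha.2.2 _ hb.2.2)
    simp [this]

/-- The dual value is a lower bound attained exactly by the tight arborescences. As one of these
exists, attaining the bound is the same as being minimum. -/
theorem isMinCostArborescence_iff [Fintype A] (h : Stage D r c k Z δ τ red mark rep)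
    (hreach : ∀ v, D.Reach mark r v) (B : Finset A) :
    D.IsMinCostArborescence r c B ↔ Tight D r k Z mark B := by
  have hge : ∀ B : Finset A, D.IsArborescence r B → (∑ i ∈ Finset.range k, δ i ≤ ∑ a ∈ B, c a) ∧
      (∑ a ∈ B, c a = ∑ i ∈ Finset.range k, δ i ↔ Tight D r k Z mark B) := by
    intro B hB
    have h1 : ∀ a ∈ B, 0 ≤ red a := fun a ha => (h.red_nonneg_of_isArborescence hreach hB ha).1
    have h2 : ∀ i ∈ Finset.range k,
        0 ≤ δ i * (((B.filter fun a => D.Enters a (Z i)).card : ℝ) - 1) :=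
      fun i hi => (h.excess_nonneg hB (Finset.mem_range.1 hi)).1
    have h3 := Finset.sum_nonneg h1
    have h4 := Finset.sum_nonneg h2
    rw [h.cost_eq B]
    refine ⟨by linarith, ?_⟩
    rw [add_eq_left, add_eq_zero_iff_of_nonneg h3 h4, Finset.sum_eq_zero_iff_of_nonneg h1,
      Finset.sum_eq_zero_iff_of_nonneg h2, Tight]
    constructor
    · rintro ⟨h5, h6⟩
      exact ⟨hB, fun a ha => (h.red_nonneg_of_isArborescence hreach hB ha).2.1 (h5 a ha),
        fun i hi => (h.excess_nonneg hB hi).2.1 (h6 i (Finset.mem_range.2 hi))⟩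
    · rintro ⟨-, h5, h6⟩
      exact ⟨fun a ha => (h.red_nonneg_of_isArborescence hreach hB ha).2.2 (h5 ha),
        fun i hi => (h.excess_nonneg hB (Finset.mem_range.1 hi)).2.2
          (h6 i (Finset.mem_range.1 hi))⟩
  obtain ⟨B₀, hB₀⟩ := h.exists_tight hreach
  constructor
  · rintro ⟨hB, hmin⟩
    refine (hge B hB).2.1 (le_antisymm ?_ (hge B hB).1)
    rw [← (hge B₀ hB₀.1).2.2 hB₀]
    exact hmin B₀ hB₀.1
  · intro hB
    refine ⟨hB.1, fun B' hB' => ?_⟩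
    rw [(hge B hB.1).2.2 hB]
    exact (hge B' hB').1

end Stage

end Optimality

/-! ### One round of dual ascent -/

section Rounds

variable {V A : Type*} [LinearOrder V]
variable {D : MultiDigraph V A} {r : V} {c : A → ℝ} {k : ℕ} {Z : ℕ → Finset V} {δ : ℕ → ℝ}
  {τ : A → ℕ} {red : A → ℝ} {mark : Set A} {rep : V → V → V}

theorem Stage.init (D : MultiDigraph V A) (r : V) (c : A → ℝ) (Z : ℕ → Finset V) (δ : ℕ → ℝ)
    (τ : A → ℕ) : Stage D r c 0 Z δ τ c ∅ (fun u _ => u) where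
  root_notMem := by simp
  nonempty := by simp
  laminar := by simp
  le_of_enters := by simp
  lt_of_mark := by simp
  strong := by simp
  exists_enters := by simp
  red_eq := by simp
  touched := by simp
  pos := by simp
  rep_spec u v huv := ⟨{u}, by simp, by simpa using huv.symm, by simp, Or.inl rfl, by simp⟩

/-- `S` is closed under marked predecessors and strongly connected by marked arcs. Hence each
earlier `Z i`, itself strongly connected, lies inside `S` or misses it, which preserves laminarity.
No arc marked before enters `S`, so old marks keep reduced cost zero. -/
theorem Stage.step (h : Stage D r c k Z δ τ red mark rep) {v₀ : V} {S : Finset V} {d : ℝ}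
    (hS : ∀ u, u ∈ S ↔ D.Reach mark u v₀) (hr : ¬ D.Reach mark r v₀)
    (hsrc : ∀ u ∈ S, D.Reach mark v₀ u) (hleast : ∀ u ∈ S, v₀ ≤ u)
    (hd : ∃ a, D.Enters a S ∧ red a = d) (hmin : ∀ a, D.Enters a S → d ≤ red a)
    {red' : A → ℝ} {mark' : Set A} {rep' : V → V → V}
    (hred : ∀ a, red' a = if D.Enters a S then red a - d else red a)
    (hmark : ∀ a, a ∈ mark' ↔ a ∈ mark ∨ (D.Enters a S ∧ red a = d))
    (hrep : ∀ u v, rep' u v = if u ∈ S ∧ v ∉ S then v₀ else rep u v) :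
    ∃ Z' δ' τ', Stage D r c (k + 1) Z' δ' τ' red' mark' rep' := by
  classical
  have hv₀ : v₀ ∈ S := (hS v₀).2 Relation.ReflTransGen.refl
  have hclosed : ∀ a ∈ mark, ¬ D.Enters a S := by
    intro a ha haS
    exact haS.1 ((hS _).2 (Relation.ReflTransGen.head ⟨a, ha, rfl, rfl⟩ ((hS _).1 haS.2)))
  have hclosed' : ∀ u v, D.Reach mark u v → v ∈ S → u ∈ S := fun u v huv hv =>
    (hS u).2 (huv.trans ((hS v).1 hv))
  have hZreach : ∀ i < k, ∀ u ∈ Z i, ∀ v ∈ Z i, D.Reach mark u v := by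
    intro i hi u hu v hv
    refine Relation.ReflTransGen.mono ?_ _ _ (h.strong i hi u hu v hv)
    rintro x y ⟨a, ha, -, h1, h2, -⟩
    exact ⟨a, ha, h1, h2⟩
  have hZS : ∀ i < k, Z i ⊆ S ∨ Disjoint (Z i) S := by
    intro i hi
    by_cases hex : ∃ x ∈ Z i, x ∈ S
    · obtain ⟨x, hx, hxS⟩ := hex
      exact Or.inl fun y hy => hclosed' y x (hZreach i hi y hy x hx) hxS
    · push Not at hex
      exact Or.inr (Finset.disjoint_left.2 hex)
  have hSS : ∀ u ∈ S, ∀ v ∈ S, D.Reach mark u v := fun u hu v hv =>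
    ((hS u).1 hu).trans (hsrc v hv)
  have hrestrict : ∀ u ∈ S, ∀ v ∈ S, Relation.ReflTransGen
      (fun x y => ∃ a ∈ mark, D.tail a = x ∧ D.head a = y ∧ x ∈ S ∧ y ∈ S) u v := by
    intro u hu v hv
    have := hSS u hu v hv
    induction this using Relation.ReflTransGen.head_induction_on with
    | refl => exact Relation.ReflTransGen.refl
    | head hab hbc ih =>
      obtain ⟨a, ha, rfl, rfl⟩ := hab
      have hh := hclosed' _ _ hbc hv
      exact Relation.ReflTransGen.head ⟨a, ha, rfl, rfl, hu, hh⟩ (ih hh)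
  -- If `S` has two nodes, each of its nodes is the head of a marked arc and was therefore raised
  -- before.
  have hin : ∀ u ∈ S, ∀ v ∈ S, u ≠ v → ∃ i < k, v ∈ Z i := by
    intro u hu v hv huv
    rcases Relation.ReflTransGen.cases_tail (hSS u hu v hv) with h1 | ⟨w, -, a, ha, -, rfl⟩
    · exact absurd h1.symm huv
    · exact h.exists_mem_of_arc ha
  -- Newly marked arcs get time `k`; values of `τ` off the marks are irrelevant.
  refine ⟨Function.update Z k S, Function.update δ k d, fun a => if a ∈ mark then τ a else k, ?_⟩
  have hZlt : ∀ i < k, Function.update Z k S i = Z i := fun i hi =>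
    Function.update_of_ne hi.ne _ _
  have hδlt : ∀ i < k, Function.update δ k d i = δ i := fun i hi =>
    Function.update_of_ne hi.ne _ _
  have hZk : Function.update Z k S k = S := Function.update_self _ _ _
  have hδk : Function.update δ k d k = d := Function.update_self _ _ _
  have hcases : ∀ i, i < k + 1 → i < k ∨ i = k := fun i hi => by omega
  refine ⟨?_, ?_, ?_, ?_, ?_, ?_, ?_, ?_, ?_, ?_, ?_⟩
  · intro i hi
    rcases hcases i hi with hi | rfl
    · rw [hZlt i hi]; exact h.root_notMem i hi
    · rw [hZk, hS]; exact hr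
  · intro i hi
    rcases hcases i hi with hi | rfl
    · rw [hZlt i hi]; exact h.nonempty i hi
    · rw [hZk]; exact ⟨v₀, hv₀⟩
  · intro j hj i hij
    rcases hcases j hj with hj | rfl
    · rw [hZlt j hj, hZlt i (hij.trans hj)]; exact h.laminar j hj i hij
    · rw [hZk, hZlt i hij]; exact hZS i hij
  · intro a ha i hi haZ
    by_cases ham : a ∈ mark
    · simp only [ham, if_true]
      rcases hcases i hi with hi | rfl
      · rw [hZlt i hi] at haZ; exact h.le_of_enters a ham i hi haZ
      · rw [hZk] at haZ; exact absurd haZ (hclosed a ham)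
    · simp only [ham, if_false]; omega
  · intro a _
    by_cases ham : a ∈ mark
    · simp only [ham, if_true]; exact (h.lt_of_mark a ham).trans (Nat.lt_succ_self k)
    · simp only [ham, if_false]; omega
  · intro i hi
    rcases hcases i hi with hi | rfl
    · rw [hZlt i hi]
      intro u hu v hv
      refine Relation.ReflTransGen.mono ?_ _ _ (h.strong i hi u hu v hv)
      rintro x y ⟨a, ha, h1, h2⟩
      exact ⟨a, (hmark a).2 (Or.inl ha), by simpa only [ha, if_true] using h1, h2⟩
    · rw [hZk]
      intro u hu v hv
      refine Relation.ReflTransGen.mono ?_ _ _ (hrestrict u hu v hv)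
      rintro x y ⟨a, ha, h1⟩
      exact ⟨a, (hmark a).2 (Or.inl ha), by
        simpa only [ha, if_true] using h.lt_of_mark a ha, h1⟩
  · intro a ha
    rcases (hmark a).1 ha with ha | ha
    · obtain ⟨i, hi, h1⟩ := h.exists_enters a ha
      exact ⟨i, hi.trans (Nat.lt_succ_self k), by rw [hZlt i hi]; exact h1⟩
    · exact ⟨k, Nat.lt_succ_self k, by rw [hZk]; exact ha.1⟩
  · intro a
    rw [Finset.sum_range_succ, hZk, hδk, Finset.sum_congr rfl (g := fun i =>
      if D.Enters a (Z i) then δ i else 0) (fun i hi => by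
        rw [hZlt i (Finset.mem_range.1 hi), hδlt i (Finset.mem_range.1 hi)]), hred, h.red_eq]
    split_ifs <;> ring
  · intro a i hi hai hne
    have hne' : (a ∈ mark' ↔ a ∈ mark ∨ (D.Enters a S ∧ red a = d)) := hmark a
    by_cases haS : D.Enters a S
    · have ham : a ∉ mark := fun ha => hclosed a ha haS
      rw [hred, if_pos haS, hne']
      refine ⟨by linarith [hmin a haS], ?_⟩
      rw [sub_eq_zero]
      simp only [ham, false_or]
      exact ⟨fun h1 => ⟨haS, h1⟩, fun h1 => h1.2⟩
    · rw [hred, if_neg haS, hne']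
      simp only [haS, false_and, or_false]
      rcases hcases i hi with hi | rfl
      · rw [hZlt i hi] at hai; exact h.touched a i hi hai hne
      · rw [hZk] at hai
        have ht : D.tail a ∈ S := by
          by_contra ht; exact haS ⟨ht, hai⟩
        obtain ⟨j, hj, h1⟩ := hin _ ht _ hai hne
        exact h.touched a j hj h1 hne
  · intro i hi u hu v hv huv
    rcases hcases i hi with hi | rfl
    · rw [hZlt i hi] at hu hv; rw [hδlt i hi]; exact h.pos i hi u hu v hv huv
    · rw [hZk] at hu hv; rw [hδk]
      -- The minimum `d` is the reduced cost of an unmarked arc into a node raised before, hence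
      -- nonzero and nonnegative.
      obtain ⟨a, haS, rfl⟩ := hd
      have hex : ∃ w ∈ S, w ≠ D.head a := by
        by_cases he : u = D.head a
        · exact ⟨v, hv, fun h1 => huv (he.trans h1.symm)⟩
        · exact ⟨u, hu, he⟩
      obtain ⟨w, hw, hwa⟩ := hex
      obtain ⟨j, hj, h1⟩ := hin w hw _ haS.2 hwa
      obtain ⟨h2, h3⟩ := h.touched a j hj h1 fun he => haS.1 (he ▸ haS.2)
      exact lt_of_le_of_ne h2 fun he => hclosed a (h3.1 he.symm) haS
  · intro u v huv
    rw [hrep]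
    by_cases huvS : u ∈ S ∧ v ∉ S
    · rw [if_pos huvS]
      -- The newest set is the largest one separating `u` from `v`, since earlier sets meeting `S`
      -- lie in it.
      refine ⟨S, huvS.1, huvS.2, ⟨hv₀, fun w hw => hleast w hw⟩,
        Or.inr ⟨k, Nat.lt_succ_self k, hZk.symm⟩, fun i hi hu _ => ?_⟩
      rcases hcases i hi with hi | rfl
      · rw [hZlt i hi] at hu ⊢
        exact (hZS i hi).resolve_right fun hdis => Finset.disjoint_left.1 hdis hu huvS.1
      · rw [hZk]
    · rw [if_neg huvS]
      obtain ⟨C, h1, h2, h3, h4, h5⟩ := h.rep_spec u v huv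
      refine ⟨C, h1, h2, h3, ?_, fun i hi hu hv => ?_⟩
      · rcases h4 with h4 | ⟨i, hi, rfl⟩
        · exact Or.inl h4
        · exact Or.inr ⟨i, hi.trans (Nat.lt_succ_self k), (hZlt i hi).symm⟩
      · rcases hcases i hi with hi | rfl
        · rw [hZlt i hi] at hu hv ⊢; exact h5 i hi hu hv
        · rw [hZk] at hu hv; exact absurd ⟨hu, hv⟩ huvS

end Rounds

/-! ### The two matroids -/

section Matroids

/-- Unit vectors indexed by the labels are independent exactly if no label repeats, so partition
matroids are linear and exist by `exists_linear_matroid`. -/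
theorem linearIndepOn_single_iff {E : Type*} (label : E → ℕ) (I : Set E) :
    LinearIndepOn ℚ (fun e => Finsupp.single (label e) (1 : ℚ)) I ↔
      ∀ j : ℕ, {e ∈ I | label e = j}.encard ≤ 1 := by
  have h1 : LinearIndepOn ℚ (fun e => Finsupp.single (label e) (1 : ℚ)) I ↔
      Set.InjOn label I := by
    constructor
    · intro h a ha b hb hab
      have := LinearIndependent.injective h
      exact congrArg Subtype.val (@this ⟨a, ha⟩ ⟨b, hb⟩ (by simp [hab]))
    · intro h
      exact (Finsupp.linearIndependent_single_one ℚ ℕ).comp (fun e : I => label e)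
        fun a b hab => Subtype.ext (h a.2 b.2 hab)
  rw [h1]
  constructor
  · intro h j
    rw [Set.encard_le_one_iff]
    exact fun a b ha hb => h ha.1 hb.1 (ha.2.trans hb.2.symm)
  · intro h a ha b hb hab
    exact Set.encard_le_one_iff.1 (h (label a)) a b ⟨ha, rfl⟩ ⟨hb, hab.symm⟩

theorem exists_isPartitionMatroid {E : Type*} [Finite E] (S : Set E) (label : E → ℕ) :
    ∃ M : Matroid E, IsPartitionMatroid S label M := by
  obtain ⟨M, h1, h2⟩ := exists_linear_matroid (K := ℚ) S
    (fun e => Finsupp.single (label e) (1 : ℚ))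
  exact ⟨M, h1, fun I => by rw [h2, linearIndepOn_single_iff]⟩

/-- The bases of a partition matroid contain exactly one element of each class. -/
theorem IsPartitionMatroid.isBase_iff {E : Type*} {S : Set E} {label : E → ℕ} {M : Matroid E}
    (h : IsPartitionMatroid S label M) {B : Set E} :
    M.IsBase B ↔ B ⊆ S ∧ ∀ e ∈ S, ∃! f, f ∈ B ∧ label f = label e := by
  rw [Matroid.isBase_iff_maximal_indep]
  have huniq : ∀ I, M.Indep I ↔ I ⊆ S ∧ ∀ a ∈ I, ∀ b ∈ I, label a = label b → a = b := by
    intro I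
    rw [h.2]
    refine and_congr_right fun _ => ⟨fun h a ha b hb hab => ?_, fun h j => ?_⟩
    · exact Set.encard_le_one_iff.1 (h (label a)) a b ⟨ha, rfl⟩ ⟨hb, hab.symm⟩
    · rw [Set.encard_le_one_iff]
      exact fun a b ha hb => h a ha.1 b hb.1 (ha.2.trans hb.2.symm)
  constructor
  · rintro ⟨hB, hmax⟩
    obtain ⟨hBS, hinj⟩ := (huniq B).1 hB
    refine ⟨hBS, fun e he => ?_⟩
    by_cases hex : ∃ f ∈ B, label f = label e
    · obtain ⟨f, hf, hfe⟩ := hex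
      exact ⟨f, ⟨hf, hfe⟩, fun g hg => hinj g hg.1 f hf (hg.2.trans hfe.symm)⟩
    · push Not at hex
      have : M.Indep (insert e B) := by
        rw [huniq]
        refine ⟨Set.insert_subset he hBS, ?_⟩
        rintro a (rfl | ha) b (rfl | hb) hab
        · rfl
        · exact absurd hab.symm (hex b hb)
        · exact absurd hab (hex a ha)
        · exact hinj a ha b hb hab
      exact absurd rfl (hex e (hmax this (Set.subset_insert e B) (Set.mem_insert e B)))
  · rintro ⟨hBS, hu⟩
    have hB : M.Indep B := (huniq B).2 ⟨hBS, fun a ha b hb hab =>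
      (hu b (hBS hb)).unique ⟨ha, hab⟩ ⟨hb, rfl⟩⟩
    refine ⟨hB, fun I hI hBI e he => ?_⟩
    obtain ⟨hIS, hinj⟩ := (huniq I).1 hI
    obtain ⟨f, hf, -⟩ := hu e (hIS he)
    rw [← hinj f (hBI hf.1) e he hf.2]; exact hf.1

theorem exists_isCycleMatroid {W E : Type*} [Finite E] {G : Graph W E} {X Y : E → W} {S : Set E}
    (hG : ∀ a x y, G.IsLink a x y ↔ a ∈ S ∧ ((X a = x ∧ Y a = y) ∨ (X a = y ∧ Y a = x))) :
    ∃ M : Matroid E, M.E = S ∧ IsCycleMatroid G M := by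
  have hS : G.edgeSet = S := by
    ext a
    rw [G.edge_mem_iff_exists_isLink]
    constructor
    · rintro ⟨x, y, h⟩; exact ((hG a x y).1 h).1
    · intro ha; exact ⟨X a, Y a, (hG _ _ _).2 ⟨ha, Or.inl ⟨rfl, rfl⟩⟩⟩
  obtain ⟨M, h1, h2⟩ := exists_linear_matroid (K := ℚ) S (edgeVec X Y)
  refine ⟨M, h1, h1.trans hS.symm, fun I => ?_⟩
  rw [h2, hS]
  exact and_congr_right fun hI => by
    rw [containsCycle_iff_not_linearIndepOn_edgeVec hG hI, not_not]

/-- A set with one edge less than nodes is a base of the cycle matroid of a connected graph if and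
only if it connects the graph. -/
theorem IsCycleMatroid.isBase_iff_conn {V W E : Type*} [Fintype V] {G : Graph W E}
    {M : Matroid E} (hM : IsCycleMatroid G M) {X Y : E → V} {ι : V → W} (hι : ι.Injective)
    {S : Set E} (hG : ∀ a x y, G.IsLink a x y ↔
      a ∈ S ∧ ((ι (X a) = x ∧ ι (Y a) = y) ∨ (ι (X a) = y ∧ ι (Y a) = x)))
    (r : V) {B : Finset E} (hBS : (B : Set E) ⊆ S)
    (hcard : B.card + 1 = Fintype.card V) :
    M.IsBase (B : Set E) ↔ ∀ v, Conn X Y B r v := by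
  have hS : G.edgeSet = S := by
    ext a
    rw [G.edge_mem_iff_exists_isLink]
    constructor
    · rintro ⟨x, y, h⟩; exact ((hG a x y).1 h).1
    · intro ha; exact ⟨_, _, (hG _ _ _).2 ⟨ha, Or.inl ⟨rfl, rfl⟩⟩⟩
  have hind : ∀ I, M.Indep I ↔ I ⊆ S ∧ LinearIndepOn ℚ (edgeVec X Y) I := by
    intro I
    rw [hM.2, hS]
    refine and_congr_right fun hI => ?_
    rw [containsCycle_iff_not_linearIndepOn_edgeVec (X := fun a => ι (X a)) (Y := fun a => ι (Y a))
      hG hI, not_not]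
    -- Output graphs live on `ℕ`, but the dimension count needs the finite node type; independence
    -- is transported along the injective linear map induced by `ι`.
    have hinj : Function.Injective (Finsupp.lmapDomain ℚ ℚ ι) := Finsupp.mapDomain_injective hι
    rw [← LinearMap.linearIndepOn_iff_of_injOn (Finsupp.lmapDomain ℚ ℚ ι) hinj.injOn]
    have : (fun a => Finsupp.lmapDomain ℚ ℚ ι (edgeVec X Y a)) =
        edgeVec (fun a => ι (X a)) (fun a => ι (Y a)) := by
      ext1 a
      rw [edgeVec, edgeVec, map_sub]
      simp [Finsupp.mapDomain_single]
    rw [← this]; rfl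
  rw [← linearIndepOn_edgeVec_iff_conn r hcard, Matroid.isBase_iff_maximal_indep]
  constructor
  · intro h
    exact ((hind _).1 h.prop).2
  · intro h
    refine ⟨(hind _).2 ⟨hBS, h⟩, fun I hI hBI e he => ?_⟩
    obtain ⟨hIS, hIl⟩ := (hind I).1 hI
    by_contra heB
    have h1 : LinearIndepOn ℚ (edgeVec X Y) (insert e (B : Set E)) :=
      hIl.mono (Set.insert_subset he hBI)
    refine h1.notMem_span_of_insert heB ?_
    rw [edgeVec, single_sub_single_mem_span_iff]
    have h2 := (linearIndepOn_edgeVec_iff_conn r hcard).1 h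
    exact (h2 _).symm.trans _ _ _ (h2 _)

end Matroids

/-! ### Programs with bounded loops -/

/-- The memory `s` with one natural-number cell overwritten. -/
def Memory.setNat (s : Memory) (T i j x : ℕ) : Memory :=
  { s with nat := writeCell s.nat T i j x }

/-- The memory `s` with one real-number cell overwritten. -/
def Memory.setReal (s : Memory) (T i j : ℕ) (x : ℝ) : Memory :=
  { s with real := writeCell s.real T i j x }

@[simp] theorem Memory.setNat_nat (s : Memory) (T i j x T' i' j' : ℕ) :
    (s.setNat T i j x).nat T' i' j' = if T' = T ∧ i' = i ∧ j' = j then x else s.nat T' i' j' :=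
  rfl

@[simp] theorem Memory.setNat_real (s : Memory) (T i j x : ℕ) :
    (s.setNat T i j x).real = s.real :=
  rfl

@[simp] theorem Memory.setReal_real (s : Memory) (T i j : ℕ) (x : ℝ) (T' i' j' : ℕ) :
    (s.setReal T i j x).real T' i' j' = if T' = T ∧ i' = i ∧ j' = j then x else s.real T' i' j' :=
  rfl

@[simp] theorem Memory.setReal_nat (s : Memory) (T i j : ℕ) (x : ℝ) :
    (s.setReal T i j x).nat = s.nat :=
  rfl

/-- The scalar variable kept in the cell `(0, 0)` of table `T`. -/
def NatExpr.var (T : ℕ) : NatExpr := .read T (.const 0) (.const 0)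

/-- Programs with bounded loops: `loop C b p` runs `p` for all values of the counter `C` below the
number in the cell `(b, 0)` of table `0`. -/
inductive Code : Type
  | skip
  | nat (T : ℕ) (i j x : NatExpr)
  | real (T : ℕ) (i j : NatExpr) (x : RealExpr)
  | seq (p q : Code)
  | ite (b : Test) (p q : Code)
  | loop (C b : ℕ) (p : Code)

namespace Code

/-- Translation to programs of the machine model. -/
def compile : Code → Program
  | skip => .skip
  | nat T i j x => .setNat T i j x
  | real T i j x => .setReal T i j x
  | seq p q => .seq p.compile q.compile
  | ite b p q => .ite b p.compile q.compile
  | loop C b p => .seq (.setNat C (.const 0) (.const 0) (.const 0))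
      (.while (.natLt (.var C) (.read 0 (.const b) (.const 0)))
        (.seq p.compile (.setNat C (.const 0) (.const 0) (.add (.var C) (.const 1)))))

open Classical in
/-- The memory after the execution. -/
noncomputable def den : Code → Memory → Memory
  | skip, s => s
  | nat T i j x, s => s.setNat T (i.eval s) (j.eval s) (x.eval s)
  | real T i j x, s => s.setReal T (i.eval s) (j.eval s) (x.eval s)
  | seq p q, s => q.den (p.den s)
  | ite b p q, s => if b.Holds s then p.den s else q.den s
  | loop C b p, s =>
      -- The number of passes is read once. This agrees with the `while` loop because well-formed
      -- bodies change neither the counter nor table `0`.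
      (fun s' => (p.den s').setNat C 0 0 ((p.den s').nat C 0 0 + 1))^[s.nat 0 b 0]
        (s.setNat C 0 0 0)

/-- The tables of naturals that are written. -/
def natWrites : Code → List ℕ
  | skip => []
  | nat T _ _ _ => [T]
  | real _ _ _ _ => []
  | seq p q => p.natWrites ++ q.natWrites
  | ite _ p q => p.natWrites ++ q.natWrites
  | loop C _ p => C :: p.natWrites

/-- The tables of reals that are written. -/
def realWrites : Code → List ℕ
  | skip => []
  | nat _ _ _ _ => []
  | real T _ _ _ => [T]
  | seq p q => p.realWrites ++ q.realWrites
  | ite _ p q => p.realWrites ++ q.realWrites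
  | loop _ _ p => p.realWrites

/-- Loop counters are not written by the body, and the bounds are the numbers of nodes and arcs,
which are not written at all. -/
def WellFormed : Code → Prop
  | skip => True
  | nat T _ _ _ => T ≠ 0
  | real _ _ _ _ => True
  | seq p q => p.WellFormed ∧ q.WellFormed
  | ite _ p q => p.WellFormed ∧ q.WellFormed
  | loop C b p => C ≠ 0 ∧ b ≤ 1 ∧ C ∉ p.natWrites ∧ p.WellFormed

/-- A bound on the running time in terms of a bound on the numbers of nodes and arcs. -/
noncomputable def cost : Code → Polynomial ℕ
  | skip => 1
  | nat _ i j x => Polynomial.C (1 + i.ops + j.ops + x.ops)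
  | real _ i j x => Polynomial.C (1 + i.ops + j.ops + x.ops)
  | seq p q => p.cost + q.cost
  | ite b p q => Polynomial.C b.ops + p.cost + q.cost
  -- Resetting the counter costs 4 and the failing test 7; each pass adds 7 for the test and 8 for
  -- the increment.
  | loop _ _ p => Polynomial.C 11 + Polynomial.X * (p.cost + Polynomial.C 15)

theorem WellFormed.zero_notMem {p : Code} (h : p.WellFormed) : 0 ∉ p.natWrites := by
  induction p with
  | skip => simp [natWrites]
  | nat T i j x => simpa [natWrites] using fun h0 => h h0.symm
  | real T i j x => simp [natWrites]
  | seq p q ihp ihq => simpa [natWrites] using ⟨ihp h.1, ihq h.2⟩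
  | ite b p q ihp ihq => simpa [natWrites] using ⟨ihp h.1, ihq h.2⟩
  | loop C b p ih => simpa [natWrites] using ⟨fun h0 => h.1 h0.symm, ih h.2.2.2⟩

/-- The frame rule: it carries untouched tables through every subroutine, with membership usually
settled by `decide`. -/
theorem den_nat_of_notMem {p : Code} {T : ℕ} (h : T ∉ p.natWrites) (s : Memory) :
    (p.den s).nat T = s.nat T := by
  induction p generalizing s with
  | skip => rfl
  | nat T' i j x =>
    have h' : T ≠ T' := by simpa [natWrites] using h
    funext i' j'
    simp [den, h']
  | real T' i j x => rfl
  | seq p q ihp ihq =>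
    simp only [natWrites, List.mem_append, not_or] at h
    rw [den, ihq h.2, ihp h.1]
  | ite b p q ihp ihq =>
    simp only [natWrites, List.mem_append, not_or] at h
    rw [den]
    split_ifs
    · exact ihp h.1 s
    · exact ihq h.2 s
  | loop C b p ih =>
    simp only [natWrites, List.mem_cons, not_or] at h
    rw [den]
    have h0 : ∀ (s' : Memory) (x : ℕ), (s'.setNat C 0 0 x).nat T = s'.nat T := by
      intro s' x; funext i' j'; simp [h.1]
    generalize s.nat 0 b 0 = k
    induction k with
    | zero => exact h0 s 0
    | succ k ihk => rw [Function.iterate_succ_apply', h0, ih h.2, ihk]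

theorem den_real_of_notMem {p : Code} {T : ℕ} (h : T ∉ p.realWrites) (s : Memory) :
    (p.den s).real T = s.real T := by
  induction p generalizing s with
  | skip => rfl
  | nat T' i j x => rfl
  | real T' i j x =>
    have h' : T ≠ T' := by simpa [realWrites] using h
    funext i' j'
    simp [den, h']
  | seq p q ihp ihq =>
    simp only [realWrites, List.mem_append, not_or] at h
    rw [den, ihq h.2, ihp h.1]
  | ite b p q ihp ihq =>
    simp only [realWrites, List.mem_append, not_or] at h
    rw [den]
    split_ifs
    · exact ihp h.1 s
    · exact ihq h.2 s
  | loop C b p ih =>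
    simp only [realWrites] at h
    rw [den]
    generalize s.nat 0 b 0 = k
    induction k with
    | zero => rfl
    | succ k ihk => rw [Function.iterate_succ_apply', Memory.setNat_real, ih h, ihk]

/-- Invariants of loops. -/
theorem den_loop {C b : ℕ} {p : Code} (hp : (loop C b p).WellFormed) {I : ℕ → Memory → Prop}
    (s : Memory) (h0 : I 0 (s.setNat C 0 0 0))
    (hstep : ∀ i < s.nat 0 b 0, ∀ s' : Memory, s'.nat C 0 0 = i →
      (∀ T, T ≠ C → T ∉ p.natWrites → s'.nat T = s.nat T) →
      (∀ T, T ∉ p.realWrites → s'.real T = s.real T) → I i s' →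
      I (i + 1) ((p.den s').setNat C 0 0 (i + 1))) :
    I (s.nat 0 b 0) ((loop C b p).den s) := by
  obtain ⟨hC, -, hCp, -⟩ := hp
  rw [den]
  set f : Memory → Memory := fun s' => (p.den s').setNat C 0 0 ((p.den s').nat C 0 0 + 1) with hf
  suffices H : ∀ k ≤ s.nat 0 b 0, I k (f^[k] (s.setNat C 0 0 0)) ∧
      (f^[k] (s.setNat C 0 0 0)).nat C 0 0 = k ∧
      (∀ T, T ≠ C → T ∉ p.natWrites → (f^[k] (s.setNat C 0 0 0)).nat T = s.nat T) ∧
      (∀ T, T ∉ p.realWrites → (f^[k] (s.setNat C 0 0 0)).real T = s.real T) from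
    (H _ le_rfl).1
  have hset : ∀ (s' : Memory) (x T : ℕ), T ≠ C → (s'.setNat C 0 0 x).nat T = s'.nat T := by
    intro s' x T hT; funext i' j'; simp [hT]
  intro k
  induction k with
  | zero => exact fun _ => ⟨h0, by simp, fun T hT _ => hset s 0 T hT, fun T _ => rfl⟩
  | succ k ih =>
    intro hk
    obtain ⟨h1, h2, h3, h4⟩ := ih (by omega)
    rw [Function.iterate_succ_apply']
    set s' := f^[k] (s.setNat C 0 0 0)
    have h5 : (p.den s').nat C 0 0 = k := by rw [den_nat_of_notMem hCp, h2]
    have h6 : f s' = (p.den s').setNat C 0 0 (k + 1) := by rw [hf]; simp only [h5]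
    rw [h6]
    refine ⟨hstep k (by omega) s' h2 h3 h4 h1, by simp, fun T hT hTp => ?_, fun T hT => ?_⟩
    · rw [hset _ _ _ hT, den_nat_of_notMem hTp, h3 T hT hTp]
    · rw [Memory.setNat_real, den_real_of_notMem hT, h4 T hT]

/-- Correctness of the translation, with the running time. -/
theorem exists_runs {p : Code} (hp : p.WellFormed) {N : ℕ} (s : Memory)
    (hN : ∀ b ≤ 1, s.nat 0 b 0 ≤ N) :
    ∃ t, Runs p.compile s t (p.den s) ∧ t ≤ p.cost.eval N := by
  induction p generalizing s with
  | skip => exact ⟨1, Runs.skip s, by simp [cost]⟩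
  | nat T i j x => exact ⟨_, Runs.setNat T i j x s, by simp [cost]⟩
  | real T i j x => exact ⟨_, Runs.setReal T i j x s, by simp [cost]⟩
  | seq p q ihp ihq =>
    obtain ⟨t, h1, h2⟩ := ihp hp.1 s hN
    obtain ⟨t', h3, h4⟩ := ihq hp.2 (p.den s) (by
      rw [den_nat_of_notMem hp.1.zero_notMem]; exact hN)
    exact ⟨t + t', Runs.seq h1 h3, by simp only [cost, Polynomial.eval_add]; omega⟩
  | ite b p q ihp ihq =>
    by_cases hb : b.Holds s
    · obtain ⟨t, h1, h2⟩ := ihp hp.1 s hN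
      refine ⟨b.ops + t, ?_, ?_⟩
      · rw [den, if_pos hb]; exact Runs.ite_true _ hb h1
      · simp only [cost, Polynomial.eval_add, Polynomial.eval_C]; omega
    · obtain ⟨t, h1, h2⟩ := ihq hp.2 s hN
      refine ⟨b.ops + t, ?_, ?_⟩
      · rw [den, if_neg hb]; exact Runs.ite_false _ hb h1
      · simp only [cost, Polynomial.eval_add, Polynomial.eval_C]; omega
  | loop C b p ih =>
    obtain ⟨hC, hb, hCp, hpw⟩ := hp
    rw [den, compile]
    set f : Memory → Memory := fun s' => (p.den s').setNat C 0 0 ((p.den s').nat C 0 0 + 1) with hf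
    have h0p := hpw.zero_notMem
    have hset : ∀ (s' : Memory) (x : ℕ), (s'.setNat C 0 0 x).nat 0 = s'.nat 0 := by
      intro s' x; funext i' j'; simp [Ne.symm hC]
    have hf0 : ∀ s', (f s').nat 0 = s'.nat 0 := by
      intro s'; rw [hf]; simp only [hset, den_nat_of_notMem h0p]
    have hfC : ∀ s', (f s').nat C 0 0 = s'.nat C 0 0 + 1 := by
      intro s'; rw [hf]; simp [den_nat_of_notMem hCp]
    have key : ∀ k, ∀ s' : Memory, (∀ b ≤ 1, s'.nat 0 b 0 ≤ N) →
        s'.nat C 0 0 + k = s'.nat 0 b 0 → ∃ t, Runs (.while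
          (.natLt (.var C) (.read 0 (.const b) (.const 0))) (.seq p.compile
          (.setNat C (.const 0) (.const 0) (.add (.var C) (.const 1))))) s' t (f^[k] s') ∧
          t ≤ 7 + k * (p.cost.eval N + 15) := by
      intro k
      induction k with
      | zero =>
        intro s' _ hk
        refine ⟨_, Runs.while_false _ ?_, ?_⟩
        · simp only [Test.Holds, NatExpr.var, NatExpr.eval]; omega
        · simp [Test.ops, NatExpr.var, NatExpr.ops]
      | succ k ihk =>
        intro s' hs' hk
        obtain ⟨t, h1, h2⟩ := ih hpw s' hs'
        obtain ⟨t', h3, h4⟩ := ihk (f s') (by rw [hf0]; exact hs') (by rw [hfC, hf0]; omega)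
        refine ⟨_, Runs.while_true ?_ (Runs.seq h1 (Runs.setNat _ _ _ _ _)) h3, ?_⟩
        · simp only [Test.Holds, NatExpr.var, NatExpr.eval]; omega
        · simp only [Test.ops, NatExpr.var, NatExpr.ops]
          rw [Nat.succ_mul]; omega
    obtain ⟨t, h1, h2⟩ := key (s.nat 0 b 0) (s.setNat C 0 0 0) (by rw [hset]; exact hN)
      (by rw [hset]; simp)
    refine ⟨_, Runs.seq (Runs.setNat _ _ _ _ _) h1, ?_⟩
    have h3 : s.nat 0 b 0 * (p.cost.eval N + 15) ≤ N * (p.cost.eval N + 15) :=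
      Nat.mul_le_mul_right _ (hN b hb)
    simp only [cost, Polynomial.eval_add, Polynomial.eval_mul, Polynomial.eval_C,
      Polynomial.eval_X, NatExpr.ops]
    omega

end Code

/-! ### The program

Table `3` of naturals holds the marks of the arcs, table `8` the representatives, table `9` the
reachability relation of the marked arcs, table `10` the current node set, and the tables `11`,
`12`, `13` hold the chosen node, the failure flag and a flag for the search of a minimum. Table `0`
of reals holds the reduced costs, and table `1` the minimum. The tables `14`, `15`, `16` hold the
loop counters. -/

namespace Code

open NatExpr (var const)

/-- The test whether the arc in the counter `14` enters the current node set. -/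
def entersTest : Test :=
  .and (.not (.natEq (.read 10 (.read 1 (var 14) (const 0)) (const 0)) (const 1)))
    (.natEq (.read 10 (.read 2 (var 14) (const 0)) (const 0)) (const 1))

/-- No arc is marked: each node reaches itself only and represents itself. -/
def initTables : Code :=
  .loop 14 0 (.seq (.nat 9 (var 14) (var 14) (const 1))
    (.loop 15 0 (.nat 8 (var 14) (var 15) (var 14))))

/-- Chooses a node that is not reached from the root. -/
def findUnreached : Code :=
  .seq (.nat 11 (const 0) (const 0) (.read 0 (const 0) (const 0)))
    (.loop 14 0 (.ite (.natEq (.read 9 (.read 0 (const 2) (const 0)) (var 14)) (const 1)) .skip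
      (.nat 11 (const 0) (const 0) (var 14))))

/-- Moves from the chosen node to the least node of a strong component without entering marked
arcs. -/
def descend : Code :=
  .loop 14 0 (.ite
    (.and (.natEq (.read 9 (var 14) (var 11)) (const 1))
      (.or (.not (.natEq (.read 9 (var 11) (var 14)) (const 1))) (.natLt (var 14) (var 11))))
    (.nat 11 (const 0) (const 0) (var 14)) .skip)

/-- Makes the nodes that reach the chosen node the current node set. -/
def copySet : Code :=
  .loop 14 0 (.nat 10 (var 14) (const 0) (.read 9 (var 14) (var 11)))

/-- Finds the least reduced cost of the arcs entering the current node set. -/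
def findMin : Code :=
  .seq (.nat 13 (const 0) (const 0) (const 0))
    (.loop 14 1 (.ite
      (.and entersTest (.or (.natEq (var 13) (const 0))
        (.realLt (.read 0 (var 14) (const 0)) (.read 1 (const 0) (const 0)))))
      (.seq (.real 1 (const 0) (const 0) (.read 0 (var 14) (const 0)))
        (.nat 13 (const 0) (const 0) (const 1)))
      .skip))

/-- Adds the arc in the counter `14` to the reachability relation. -/
def addArc : Code :=
  .loop 15 0 (.loop 16 0 (.ite
    (.and (.natEq (.read 9 (var 15) (.read 1 (var 14) (const 0))) (const 1))
      (.natEq (.read 9 (.read 2 (var 14) (const 0)) (var 16)) (const 1)))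
    (.nat 9 (var 15) (var 16) (const 1)) .skip))

/-- Lowers the reduced costs of the arcs entering the current node set, and marks new tight arcs. -/
def lowerCosts : Code :=
  .loop 14 1 (.ite entersTest
    (.seq (.real 0 (var 14) (const 0)
        (.sub (.read 0 (var 14) (const 0)) (.read 1 (const 0) (const 0))))
      (.ite (.realEq (.read 0 (var 14) (const 0)) .zero)
        (.seq (.nat 3 (var 14) (const 0) (const 1)) addArc) .skip))
    .skip)

/-- Makes the chosen node the representative of the current node set. -/
def updateReps : Code :=
  .loop 14 0 (.loop 15 0 (.ite
    (.and (.natEq (.read 10 (var 14) (const 0)) (const 1))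
      (.not (.natEq (.read 10 (var 15) (const 0)) (const 1))))
    (.nat 8 (var 14) (var 15) (var 11)) .skip))

/-- One round of the primal-dual method. -/
def round : Code :=
  .seq findUnreached (.ite (.natLt (var 11) (.read 0 (const 0) (const 0)))
    (.seq descend (.seq copySet (.seq findMin (.ite (.natEq (var 13) (const 1))
      (.seq lowerCosts updateReps)
      (.nat 12 (const 0) (const 0) (const 1))))))
    .skip)

/-- The output of a loop if there is no arborescence. -/
def writeFailure : Code :=
  .seq (.loop 14 1 (.nat 3 (var 14) (const 0) (const 0)))
    (.seq (.nat 3 (const 0) (const 0) (const 1)) (.nat 4 (const 0) (const 0) (const 1)))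

/-- The output of the two matroids on the marked arcs. -/
def writeMatroids : Code :=
  .seq (.nat 4 (const 0) (const 0) (.read 0 (const 0) (const 0)))
    (.loop 14 1 (.seq
      (.nat 5 (var 14) (const 0)
        (.read 8 (.read 1 (var 14) (const 0)) (.read 2 (var 14) (const 0))))
      (.seq
        (.nat 6 (var 14) (const 0)
          (.read 8 (.read 2 (var 14) (const 0)) (.read 1 (var 14) (const 0))))
        (.nat 7 (var 14) (const 0) (.read 2 (var 14) (const 0))))))

/-- The whole algorithm. -/
def main : Code :=
  .seq initTables (.seq (.seq (.loop 17 1 round) round)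
    (.ite (.natEq (var 12) (const 1)) writeFailure writeMatroids))

theorem wellFormed_main : main.WellFormed := by
  simp [main, initTables, round, findUnreached, descend, copySet, findMin, lowerCosts, addArc,
    updateReps, writeFailure, writeMatroids, WellFormed, natWrites]

/-! ### Correctness of the subroutines -/

theorem den_initTables (s : Memory) {n : ℕ} (hn : s.nat 0 0 0 = n)
    (h9 : ∀ u v, s.nat 9 u v = 0) :
    (∀ u < n, ∀ v < n, (initTables.den s).nat 8 u v = u) ∧
      ∀ u < n, ∀ v < n, ((initTables.den s).nat 9 u v = 1 ↔ u = v) := by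
  have h := den_loop (C := 14) (b := 0)
    (p := .seq (.nat 9 (var 14) (var 14) (const 1))
      (.loop 15 0 (.nat 8 (var 14) (var 15) (var 14))))
    (by simp [WellFormed, natWrites])
    (I := fun i s' => (∀ u < i, ∀ v < n, s'.nat 8 u v = u) ∧
      ∀ u v, s'.nat 9 u v = if u = v ∧ u < i then 1 else 0) s
    ⟨by simp, by simp [h9]⟩ ?_
  · rw [hn] at h
    refine ⟨h.1, fun u hu v _ => ?_⟩
    have := h.2 u v
    change ((loop 14 0 _).den s).nat 9 u v = 1 ↔ _
    rw [this]; simp [hu]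
  · intro i hi s' hc hfr _ ⟨h1, h2⟩
    rw [hn] at hi
    have h0 : s'.nat 0 0 0 = n := by rw [hfr 0 (by decide) (by decide), hn]
    rw [den]
    set s₁ := (Code.nat 9 (var 14) (var 14) (const 1)).den s' with hs₁
    have hs9 : ∀ u v, s₁.nat 9 u v = if u = i ∧ v = i then 1 else s'.nat 9 u v := by
      intro u v; simp [hs₁, den, NatExpr.eval, var, hc]
    have hs8 : ∀ u v, s₁.nat 8 u v = s'.nat 8 u v := by
      intro u v; simp [hs₁, den]
    have hs14 : s₁.nat 14 0 0 = i := by simp [hs₁, den, hc]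
    have hs0 : s₁.nat 0 0 0 = n := by simp [hs₁, den, h0]
    have hin := den_loop (C := 15) (b := 0) (p := .nat 8 (var 14) (var 15) (var 14))
      (by simp [WellFormed, natWrites])
      (I := fun j t => ∀ u v, t.nat 8 u v = if u = i ∧ v < j then i else s'.nat 8 u v) s₁
      (by simp [hs8]) (by
        intro j _ t hj hfr' _ hI u v
        have h14 : t.nat 14 0 0 = i := by rw [hfr' 14 (by decide) (by decide), hs14]
        simp only [den, NatExpr.eval, var, hj, h14, Memory.setNat_nat, hI]
        split_ifs <;> grind)
    rw [hs0] at hin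
    constructor
    · intro u hu v hv
      have := hin u v
      simp only [Memory.setNat_nat, this]
      by_cases hui : u = i
      · simp [hui, hv]
      · simp [hui, h1 u (by omega) v hv]
    · intro u v
      simp only [Memory.setNat_nat]
      rw [den_nat_of_notMem (by decide), hs9, h2]
      split_ifs <;> grind

/-- The value `n`, which is no node, signals that everything is reached. -/
theorem den_findUnreached (s : Memory) {n : ℕ} (hn : s.nat 0 0 0 = n) :
    ((findUnreached.den s).nat 11 0 0 = n ∧ ∀ v < n, s.nat 9 (s.nat 0 2 0) v = 1) ∨
      ((findUnreached.den s).nat 11 0 0 < n ∧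
        s.nat 9 (s.nat 0 2 0) ((findUnreached.den s).nat 11 0 0) ≠ 1) := by
  rw [findUnreached, den]
  set s₁ := (Code.nat 11 (const 0) (const 0) (.read 0 (const 0) (const 0))).den s with hs₁
  have h1 : s₁.nat 11 0 0 = n := by simp [hs₁, den, NatExpr.eval, hn]
  have hfr : ∀ T, T ≠ 11 → s₁.nat T = s.nat T := fun T hT =>
    den_nat_of_notMem (by simpa [natWrites] using hT) s
  have h := den_loop (C := 14) (b := 0)
    (p := .ite (.natEq (.read 9 (.read 0 (const 2) (const 0)) (var 14)) (const 1)) .skip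
      (.nat 11 (const 0) (const 0) (var 14)))
    (by simp [WellFormed, natWrites])
    (I := fun i s' => (s'.nat 11 0 0 = n ∧ ∀ v < i, s.nat 9 (s.nat 0 2 0) v = 1) ∨
      (s'.nat 11 0 0 < n ∧ s.nat 9 (s.nat 0 2 0) (s'.nat 11 0 0) ≠ 1)) s₁
    (Or.inl ⟨by simp [h1], by simp⟩) ?_
  · rw [hfr 0 (by decide), hn] at h
    exact h
  · intro i hi s' hc hfr' _ hI
    rw [hfr 0 (by decide), hn] at hi
    have e0 : s'.nat 0 = s.nat 0 := by rw [hfr' 0 (by decide) (by decide), hfr 0 (by decide)]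
    have e9 : s'.nat 9 = s.nat 9 := by rw [hfr' 9 (by decide) (by decide), hfr 9 (by decide)]
    by_cases ht : s.nat 9 (s.nat 0 2 0) i = 1
    · have : (Code.den (.ite (.natEq (.read 9 (.read 0 (const 2) (const 0)) (var 14)) (const 1))
          .skip (.nat 11 (const 0) (const 0) (var 14))) s') = s' := by
        rw [den, if_pos]
        · rfl
        · simpa [Test.Holds, NatExpr.eval, var, e0, e9, hc] using ht
      rw [this]
      rcases hI with ⟨h2, h3⟩ | h2
      · left
        refine ⟨by simpa using h2, fun v hv => ?_⟩
        rcases Nat.lt_succ_iff_lt_or_eq.1 hv with hv | rfl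
        · exact h3 v hv
        · exact ht
      · right; simpa using h2
    · right
      rw [den, if_neg (by simpa [Test.Holds, NatExpr.eval, var, e0, e9, hc] using ht)]
      simpa [den, NatExpr.eval, var, hc] using ⟨hi, ht⟩

/-- One pass suffices. When `i` replaces `w`, an earlier node reaching `i` also reaches `w`, so by
the invariant it is reached from `w` and is at least `w`; this contradicts whichever reason caused
the replacement. -/
theorem den_descend (s : Memory) {n : ℕ} (hn : s.nat 0 0 0 = n) {r : ℕ} (hr : r < n)
    (hrefl : ∀ u < n, s.nat 9 u u = 1)
    (htrans : ∀ u < n, ∀ v < n, ∀ w < n, s.nat 9 u v = 1 → s.nat 9 v w = 1 → s.nat 9 u w = 1)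
    (h11 : s.nat 11 0 0 < n) (hnr : s.nat 9 r (s.nat 11 0 0) ≠ 1) :
    ∃ w < n, (descend.den s).nat 11 0 0 = w ∧ s.nat 9 r w ≠ 1 ∧
      ∀ u < n, s.nat 9 u w = 1 → s.nat 9 w u = 1 ∧ w ≤ u := by
  have h := den_loop (C := 14) (b := 0)
    (p := .ite
      (.and (.natEq (.read 9 (var 14) (var 11)) (const 1))
        (.or (.not (.natEq (.read 9 (var 11) (var 14)) (const 1))) (.natLt (var 14) (var 11))))
      (.nat 11 (const 0) (const 0) (var 14)) .skip)
    (by simp [WellFormed, natWrites])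
    (I := fun i s' => ∃ w < n, s'.nat 11 0 0 = w ∧ s.nat 9 r w ≠ 1 ∧
      ∀ u < n, u < i → s.nat 9 u w = 1 → s.nat 9 w u = 1 ∧ w ≤ u) s
    ⟨_, h11, by simp, hnr, by simp⟩ ?_
  · rw [hn] at h
    obtain ⟨w, h1, h2, h3, h4⟩ := h
    exact ⟨w, h1, h2, h3, fun u hu => h4 u hu hu⟩
  · rintro i hi s' hc hfr - ⟨w, hw, h1, h2, h3⟩
    rw [hn] at hi
    have e9 : s'.nat 9 = s.nat 9 := hfr 9 (by decide) (by decide)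
    by_cases ht : s.nat 9 i w = 1 ∧ (s.nat 9 w i ≠ 1 ∨ i < w)
    · refine ⟨i, hi, ?_, fun h4 => h2 (htrans r hr i hi w hw h4 ht.1), fun u hu hui huv => ?_⟩
      · rw [den, if_pos (by simpa [Test.Holds, NatExpr.eval, var, e9, hc, h1] using ht)]
        simp [den, NatExpr.eval, var, hc]
      · rcases Nat.lt_succ_iff_lt_or_eq.1 hui with hui | rfl
        · obtain ⟨h4, h5⟩ := h3 u hu hui (htrans u hu i hi w hw huv ht.1)
          rcases ht.2 with h6 | h6
          · exact absurd (htrans w hw u hu i hi h4 huv) h6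
          · omega
        · exact ⟨hrefl u hu, le_rfl⟩
    · refine ⟨w, hw, ?_, h2, fun u hu hui huv => ?_⟩
      · rw [den, if_neg (by simpa [Test.Holds, NatExpr.eval, var, e9, hc, h1] using ht)]
        simpa [den] using h1
      · rcases Nat.lt_succ_iff_lt_or_eq.1 hui with hui | rfl
        · exact h3 u hu hui huv
        · by_contra h4
          refine ht ⟨huv, ?_⟩
          by_contra h5
          push Not at h5
          exact h4 h5

theorem den_copySet (s : Memory) {n : ℕ} (hn : s.nat 0 0 0 = n) :
    ∀ u < n, (copySet.den s).nat 10 u 0 = s.nat 9 u (s.nat 11 0 0) := by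
  have h := den_loop (C := 14) (b := 0)
    (p := .nat 10 (var 14) (const 0) (.read 9 (var 14) (var 11)))
    (by simp [WellFormed, natWrites])
    (I := fun i s' => ∀ u < i, s'.nat 10 u 0 = s.nat 9 u (s.nat 11 0 0)) s (by simp) ?_
  · rwa [hn] at h
  · intro i hi s' hc hfr _ hI u hu
    have e9 : s'.nat 9 = s.nat 9 := hfr 9 (by decide) (by decide)
    have e11 : s'.nat 11 = s.nat 11 := hfr 11 (by decide) (by decide)
    simp only [den, NatExpr.eval, var, Memory.setNat_nat, hc, e9, e11]
    rcases Nat.lt_succ_iff_lt_or_eq.1 hu with hu | rfl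
    · simp [hu.ne, hI u hu]
    · simp

/-- The arc `a` enters the current node set. -/
def EntersAt (s : Memory) (a : ℕ) : Prop :=
  s.nat 10 (s.nat 1 a 0) 0 ≠ 1 ∧ s.nat 10 (s.nat 2 a 0) 0 = 1

theorem holds_entersTest {s : Memory} {i : ℕ} (hi : s.nat 14 0 0 = i) :
    entersTest.Holds s ↔ EntersAt s i := by
  simp [entersTest, Test.Holds, NatExpr.eval, var, EntersAt, hi]

theorem entersAt_congr {s s' : Memory} (h1 : s'.nat 1 = s.nat 1) (h2 : s'.nat 2 = s.nat 2)
    (h10 : s'.nat 10 = s.nat 10) (a : ℕ) : EntersAt s' a ↔ EntersAt s a := by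
  rw [EntersAt, EntersAt, h1, h2, h10]

/-- No infinite cost is available as a starting value, so a flag records whether the minimum cell is
meaningful. -/
theorem den_findMin (s : Memory) {m : ℕ} (hm : s.nat 0 1 0 = m) :
    ((findMin.den s).nat 13 0 0 = 0 ∧ ∀ a < m, ¬ EntersAt s a) ∨
      ((findMin.den s).nat 13 0 0 = 1 ∧
        (∃ a < m, EntersAt s a ∧ s.real 0 a 0 = (findMin.den s).real 1 0 0) ∧
        ∀ a < m, EntersAt s a → (findMin.den s).real 1 0 0 ≤ s.real 0 a 0) := by
  rw [findMin, den]
  set s₁ := (Code.nat 13 (const 0) (const 0) (const 0)).den s with hs₁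
  have h1 : s₁.nat 13 0 0 = 0 := by simp [hs₁, den, NatExpr.eval]
  have hfr : ∀ T, T ≠ 13 → s₁.nat T = s.nat T := fun T hT =>
    den_nat_of_notMem (by simpa [natWrites] using hT) s
  have h := den_loop (C := 14) (b := 1)
    (p := .ite
      (.and entersTest (.or (.natEq (var 13) (const 0))
        (.realLt (.read 0 (var 14) (const 0)) (.read 1 (const 0) (const 0)))))
      (.seq (.real 1 (const 0) (const 0) (.read 0 (var 14) (const 0)))
        (.nat 13 (const 0) (const 0) (const 1)))
      .skip)
    (by simp [WellFormed, natWrites])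
    (I := fun i s' => (s'.nat 13 0 0 = 0 ∧ ∀ a < i, ¬ EntersAt s a) ∨
      (s'.nat 13 0 0 = 1 ∧ (∃ a < i, EntersAt s a ∧ s.real 0 a 0 = s'.real 1 0 0) ∧
        ∀ a < i, EntersAt s a → s'.real 1 0 0 ≤ s.real 0 a 0)) s₁
    (Or.inl ⟨by simp [h1], by simp⟩) ?_
  · rw [hfr 0 (by decide), hm] at h
    exact h
  · intro i hi s' hc hfr' hfr'' hI
    have er : s'.real 0 = s.real 0 := hfr'' 0 (by decide)
    have hent : entersTest.Holds s' ↔ EntersAt s i := by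
      rw [holds_entersTest hc]
      exact entersAt_congr (by rw [hfr' 1 (by decide) (by decide), hfr 1 (by decide)])
        (by rw [hfr' 2 (by decide) (by decide), hfr 2 (by decide)])
        (by rw [hfr' 10 (by decide) (by decide), hfr 10 (by decide)]) i
    by_cases ht : EntersAt s i ∧ (s'.nat 13 0 0 = 0 ∨ s.real 0 i 0 < s'.real 1 0 0)
    · right
      rw [den, if_pos (by
        simpa [Test.Holds, NatExpr.eval, RealExpr.eval, var, hent, hc, er] using ht)]
      have e : ((Code.seq (.real 1 (const 0) (const 0) (.read 0 (var 14) (const 0)))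
        (.nat 13 (const 0) (const 0) (const 1))).den s').real 1 0 0 = s.real 0 i 0 := by
        simp [den, NatExpr.eval, RealExpr.eval, var, hc, er]
      simp only [Memory.setNat_real, e]
      refine ⟨by simp [den, NatExpr.eval], ⟨i, Nat.lt_succ_self i, ht.1, rfl⟩, fun a ha haE => ?_⟩
      rcases Nat.lt_succ_iff_lt_or_eq.1 ha with ha | rfl
      · rcases hI with ⟨-, h3⟩ | ⟨h3, -, h4⟩
        · exact absurd haE (h3 a ha)
        · rcases ht.2 with h5 | h5
          · omega
          · exact h5.le.trans (h4 a ha haE)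
      · exact le_rfl
    · rw [den, if_neg (by
        simpa [Test.Holds, NatExpr.eval, RealExpr.eval, var, hent, hc, er] using ht)]
      rcases hI with ⟨h2, h3⟩ | ⟨h2, ⟨a, ha, h3⟩, h4⟩
      · left
        refine ⟨by simpa [den] using h2, fun a ha haE => ?_⟩
        rcases Nat.lt_succ_iff_lt_or_eq.1 ha with ha | rfl
        · exact h3 a ha haE
        · exact ht ⟨haE, Or.inl h2⟩
      · right
        refine ⟨by simpa [den] using h2, ⟨a, by omega, by simpa [den] using h3⟩, fun b hb hbE => ?_⟩
        simp only [Memory.setNat_real, den]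
        rcases Nat.lt_succ_iff_lt_or_eq.1 hb with hb | rfl
        · exact h4 b hb hbE
        · by_contra h5
          exact ht ⟨hbE, Or.inr (not_le.1 h5)⟩

/-- The update may overwrite the relation in place: column `x` and row `y`, the only cells tested,
never change their truth value, as a pair added there satisfied the relation already. -/
theorem den_addArc (s : Memory) {n : ℕ} (hn : s.nat 0 0 0 = n) {x y : ℕ}
    (hx : s.nat 1 (s.nat 14 0 0) 0 = x) (hy : s.nat 2 (s.nat 14 0 0) 0 = y) :
    ∀ u < n, ∀ v < n, ((addArc.den s).nat 9 u v = 1 ↔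
      s.nat 9 u v = 1 ∨ (s.nat 9 u x = 1 ∧ s.nat 9 y v = 1)) := by
  have h := den_loop (C := 15) (b := 0)
    (p := .loop 16 0 (.ite
      (.and (.natEq (.read 9 (var 15) (.read 1 (var 14) (const 0))) (const 1))
        (.natEq (.read 9 (.read 2 (var 14) (const 0)) (var 16)) (const 1)))
      (.nat 9 (var 15) (var 16) (const 1)) .skip))
    (by simp [WellFormed, natWrites])
    (I := fun i s' => ∀ u v, (s'.nat 9 u v = 1 ↔
      s.nat 9 u v = 1 ∨ (u < i ∧ v < n ∧ s.nat 9 u x = 1 ∧ s.nat 9 y v = 1))) s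
    (by simp) ?_
  · rw [hn] at h
    intro u hu v hv
    have h1 := h u v
    simp only [hu, hv, true_and] at h1
    exact h1
  · intro i hi s₁ hc hfr _ hI u v
    have e0 : s₁.nat 0 0 0 = n := by rw [hfr 0 (by decide) (by decide), hn]
    have h' := den_loop (C := 16) (b := 0)
      (p := .ite
        (.and (.natEq (.read 9 (var 15) (.read 1 (var 14) (const 0))) (const 1))
          (.natEq (.read 9 (.read 2 (var 14) (const 0)) (var 16)) (const 1)))
        (.nat 9 (var 15) (var 16) (const 1)) .skip)
      (by simp [WellFormed, natWrites])
      (I := fun j s' => ∀ u v, (s'.nat 9 u v = 1 ↔ s.nat 9 u v = 1 ∨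
        (((u < i ∧ v < n) ∨ (u = i ∧ v < j)) ∧ s.nat 9 u x = 1 ∧ s.nat 9 y v = 1))) s₁
      (by intro u v; simpa [and_assoc] using hI u v) ?_
    · rw [e0] at h'
      have h2 := h' u v
      rw [Memory.setNat_nat, if_neg (by simp), h2]
      have h3 : (u < i ∧ v < n ∨ u = i ∧ v < n) ↔ u < i + 1 ∧ v < n := by omega
      rw [h3, and_assoc]
    · intro j _ s₂ hc₂ hfr₂ _ hJ u v
      have e15 : s₂.nat 15 0 0 = i := by rw [hfr₂ 15 (by decide) (by decide), hc]
      have ex : s₂.nat 1 (s₂.nat 14 0 0) 0 = x := by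
        rw [hfr₂ 1 (by decide) (by decide), hfr₂ 14 (by decide) (by decide),
          hfr 1 (by decide) (by decide), hfr 14 (by decide) (by decide), hx]
      have ey : s₂.nat 2 (s₂.nat 14 0 0) 0 = y := by
        rw [hfr₂ 2 (by decide) (by decide), hfr₂ 14 (by decide) (by decide),
          hfr 2 (by decide) (by decide), hfr 14 (by decide) (by decide), hy]
      have hix : s₂.nat 9 i x = 1 ↔ s.nat 9 i x = 1 := by
        rw [hJ]; tauto
      have hyj : s₂.nat 9 y j = 1 ↔ s.nat 9 y j = 1 := by
        rw [hJ]; tauto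
      rw [Memory.setNat_nat, if_neg (by simp)]
      by_cases ht : s.nat 9 i x = 1 ∧ s.nat 9 y j = 1
      · rw [den, if_pos (by
          simpa [Test.Holds, NatExpr.eval, var, e15, ex, ey, hc₂, hix, hyj] using ht)]
        simp only [den, NatExpr.eval, var, Memory.setNat_nat, e15, hc₂, true_and]
        by_cases huv : u = i ∧ v = j
        · obtain ⟨rfl, rfl⟩ := huv
          simp [ht]
        · rw [if_neg huv, hJ]
          refine or_congr_right (and_congr_left fun _ => ?_)
          omega
      · rw [den, if_neg (by
          simpa [Test.Holds, NatExpr.eval, var, e15, ex, ey, hc₂, hix, hyj] using ht)]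
        rw [den, hJ]
        refine or_congr_right ?_
        by_cases huv : u = i ∧ v = j
        · obtain ⟨rfl, rfl⟩ := huv
          simp [ht]
        · refine and_congr_left fun _ => ?_
          omega

theorem den_updateReps (s : Memory) {n : ℕ} (hn : s.nat 0 0 0 = n) :
    ∀ u < n, ∀ v < n, (updateReps.den s).nat 8 u v =
      if s.nat 10 u 0 = 1 ∧ s.nat 10 v 0 ≠ 1 then s.nat 11 0 0 else s.nat 8 u v := by
  have h := den_loop (C := 14) (b := 0)
    (p := .loop 15 0 (.ite
      (.and (.natEq (.read 10 (var 14) (const 0)) (const 1))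
        (.not (.natEq (.read 10 (var 15) (const 0)) (const 1))))
      (.nat 8 (var 14) (var 15) (var 11)) .skip))
    (by simp [WellFormed, natWrites])
    (I := fun i s' => ∀ u v, s'.nat 8 u v =
      if (u < i ∧ v < n) ∧ s.nat 10 u 0 = 1 ∧ s.nat 10 v 0 ≠ 1 then s.nat 11 0 0
      else s.nat 8 u v) s (by simp) ?_
  · rw [hn] at h
    intro u hu v hv
    have h1 := h u v
    simp only [hu, hv, true_and] at h1
    exact h1
  · intro i hi s₁ hc hfr _ hI u v
    have e0 : s₁.nat 0 0 0 = n := by rw [hfr 0 (by decide) (by decide), hn]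
    have h' := den_loop (C := 15) (b := 0)
      (p := .ite
        (.and (.natEq (.read 10 (var 14) (const 0)) (const 1))
          (.not (.natEq (.read 10 (var 15) (const 0)) (const 1))))
        (.nat 8 (var 14) (var 15) (var 11)) .skip)
      (by simp [WellFormed, natWrites])
      (I := fun j s' => ∀ u v, s'.nat 8 u v =
        if ((u < i ∧ v < n) ∨ (u = i ∧ v < j)) ∧ s.nat 10 u 0 = 1 ∧ s.nat 10 v 0 ≠ 1
        then s.nat 11 0 0 else s.nat 8 u v) s₁
      (by intro u v; simpa using hI u v) ?_
    · rw [e0] at h'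
      have h2 := h' u v
      rw [Memory.setNat_nat, if_neg (by simp), h2]
      refine if_congr (and_congr_left fun _ => ?_) rfl rfl
      omega
    · intro j _ s₂ hc₂ hfr₂ _ hJ u v
      have e14 : s₂.nat 14 0 0 = i := by rw [hfr₂ 14 (by decide) (by decide), hc]
      have e10 : s₂.nat 10 = s.nat 10 := by
        rw [hfr₂ 10 (by decide) (by decide), hfr 10 (by decide) (by decide)]
      have e11 : s₂.nat 11 = s.nat 11 := by
        rw [hfr₂ 11 (by decide) (by decide), hfr 11 (by decide) (by decide)]
      rw [Memory.setNat_nat, if_neg (by simp)]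
      by_cases ht : s.nat 10 i 0 = 1 ∧ s.nat 10 j 0 ≠ 1
      · rw [den, if_pos (by
          simpa [Test.Holds, NatExpr.eval, var, e14, e10, hc₂] using ht)]
        simp only [den, NatExpr.eval, var, Memory.setNat_nat, e14, e11, hc₂, true_and]
        by_cases huv : u = i ∧ v = j
        · obtain ⟨rfl, rfl⟩ := huv
          simp [ht]
        · rw [if_neg huv, hJ]
          refine if_congr (and_congr_left fun _ => ?_) rfl rfl
          omega
      · rw [den, if_neg (by
          simpa [Test.Holds, NatExpr.eval, var, e14, e10, hc₂] using ht)]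
        rw [den, hJ]
        by_cases huv : u = i ∧ v = j
        · obtain ⟨rfl, rfl⟩ := huv
          simp [ht]
        · refine if_congr (and_congr_left fun _ => ?_) rfl rfl
          omega

end Code

/-- Cut a path before the first and after the last use of the new arc. This is the update rule for
the reachability table. -/
theorem MultiDigraph.reach_insert_iff {V A : Type*} {D : MultiDigraph V A} {B : Set A} {a : A}
    {u v : V} : D.Reach (insert a B) u v ↔
      D.Reach B u v ∨ (D.Reach B u (D.tail a) ∧ D.Reach B (D.head a) v) := by
  have hmono : ∀ {u v}, D.Reach B u v → D.Reach (insert a B) u v := fun {u v} h =>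
    Relation.ReflTransGen.mono (r := D.Arc B)
      (fun _ _ ⟨b, hb, h1⟩ => ⟨b, Set.mem_insert_of_mem a hb, h1⟩) _ _ h
  constructor
  · intro h
    induction h with
    | refl => exact Or.inl Relation.ReflTransGen.refl
    | tail _ hbc ih =>
      obtain ⟨b, hb, rfl, rfl⟩ := hbc
      rcases Set.mem_insert_iff.1 hb with rfl | hb
      · rcases ih with h1 | ⟨h1, -⟩
        · exact Or.inr ⟨h1, Relation.ReflTransGen.refl⟩
        · exact Or.inr ⟨h1, Relation.ReflTransGen.refl⟩
      · rcases ih with h1 | ⟨h1, h2⟩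
        · exact Or.inl (h1.tail ⟨b, hb, rfl, rfl⟩)
        · exact Or.inr ⟨h1, h2.tail ⟨b, hb, rfl, rfl⟩⟩
  · rintro (h | ⟨h1, h2⟩)
    · exact hmono h
    · exact ((hmono h1).tail ⟨a, Set.mem_insert a B, rfl, rfl⟩).trans (hmono h2)

/-! ### Memories that represent a stage -/

section Encoding

variable {n m : ℕ} {D : MultiDigraph (Fin n) (Fin m)} {r : Fin n} {c : Fin m → ℝ}

/-- The input cells of the memory `s` describe `D` and `r`. -/
structure Describes (D : MultiDigraph (Fin n) (Fin m)) (r : Fin n) (s : Memory) : Prop where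
  nodes : s.nat 0 0 0 = n
  arcs : s.nat 0 1 0 = m
  root : s.nat 0 2 0 = r
  tail : ∀ a : Fin m, s.nat 1 a 0 = D.tail a
  head : ∀ a : Fin m, s.nat 2 a 0 = D.head a

/-- The memory `s` represents a state of the primal-dual method. -/
structure Encodes (D : MultiDigraph (Fin n) (Fin m)) (r : Fin n) (red : Fin m → ℝ)
    (mark : Set (Fin m)) (rep : Fin n → Fin n → Fin n) (s : Memory) : Prop
    extends Describes D r s where
  mark_iff : ∀ a : Fin m, s.nat 3 a 0 = 1 ↔ a ∈ mark
  red_eq : ∀ a : Fin m, s.real 0 a 0 = red a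
  rep_eq : ∀ u v : Fin n, s.nat 8 u v = rep u v
  reach_iff : ∀ u v : Fin n, s.nat 9 u v = 1 ↔ D.Reach mark u v

theorem Describes.congr {s s' : Memory} (h : Describes D r s) (h0 : s'.nat 0 = s.nat 0)
    (h1 : s'.nat 1 = s.nat 1) (h2 : s'.nat 2 = s.nat 2) : Describes D r s' :=
  ⟨by rw [h0, h.nodes], by rw [h0, h.arcs], by rw [h0, h.root], fun a => by rw [h1, h.tail],
    fun a => by rw [h2, h.head]⟩

theorem describes_den {s : Memory} (h : Describes D r s) {p : Code} (h0 : 0 ∉ p.natWrites)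
    (h1 : 1 ∉ p.natWrites) (h2 : 2 ∉ p.natWrites) : Describes D r (p.den s) :=
  h.congr (Code.den_nat_of_notMem h0 s) (Code.den_nat_of_notMem h1 s)
    (Code.den_nat_of_notMem h2 s)

variable {red : Fin m → ℝ} {mark : Set (Fin m)} {rep : Fin n → Fin n → Fin n}

theorem Encodes.congr {s s' : Memory} (h : Encodes D r red mark rep s) (hd : Describes D r s')
    (h3 : s'.nat 3 = s.nat 3) (h8 : s'.nat 8 = s.nat 8) (h9 : s'.nat 9 = s.nat 9)
    (hr : s'.real 0 = s.real 0) : Encodes D r red mark rep s' :=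
  ⟨hd, fun a => by rw [h3, h.mark_iff], fun a => by rw [hr, h.red_eq], fun u v => by rw [h8, h.rep_eq],
    fun u v => by rw [h9, h.reach_iff]⟩

theorem Encodes.den {s : Memory} (h : Encodes D r red mark rep s) {p : Code}
    (hp : ∀ T ∈ [0, 1, 2, 3, 8, 9], T ∉ p.natWrites) (hr : 0 ∉ p.realWrites) :
    Encodes D r red mark rep (p.den s) :=
  h.congr (describes_den h.toDescribes (hp 0 (by decide)) (hp 1 (by decide)) (hp 2 (by decide)))
    (Code.den_nat_of_notMem (hp 3 (by decide)) s) (Code.den_nat_of_notMem (hp 8 (by decide)) s)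
    (Code.den_nat_of_notMem (hp 9 (by decide)) s) (Code.den_real_of_notMem hr s)

theorem Describes.entersAt_iff {s : Memory} (h : Describes D r s) {S : Finset (Fin n)}
    (hS : ∀ u : Fin n, s.nat 10 u 0 = 1 ↔ u ∈ S) (a : Fin m) :
    Code.EntersAt s a ↔ D.Enters a S := by
  rw [Code.EntersAt, h.tail, h.head, ne_eq, hS, hS]

/-- After `i` passes the memory encodes the state in which only arcs below `i` have been treated.
Marks and reachability are updated together, while the entering test uses the separate copy of `S`
and is not disturbed. -/
theorem Encodes.den_lowerCosts {s : Memory} (h : Encodes D r red mark rep s)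
    {S : Finset (Fin n)} (hS : ∀ u : Fin n, s.nat 10 u 0 = 1 ↔ u ∈ S) {d : ℝ}
    (hd : s.real 1 0 0 = d) :
    Encodes D r (fun a => if D.Enters a S then red a - d else red a)
      {a | a ∈ mark ∨ (D.Enters a S ∧ red a = d)} rep (Code.lowerCosts.den s) := by
  have h0 : Encodes D r red mark rep (s.setNat 14 0 0 0) :=
    h.congr (h.toDescribes.congr (by funext i j; simp) (by funext i j; simp)
      (by funext i j; simp)) (by funext i j; simp) (by funext i j; simp) (by funext i j; simp) rfl
  have hI := Code.den_loop (C := 14) (b := 1)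
    (p := .ite Code.entersTest
      (.seq (.real 0 (.var 14) (.const 0)
          (.sub (.read 0 (.var 14) (.const 0)) (.read 1 (.const 0) (.const 0))))
        (.ite (.realEq (.read 0 (.var 14) (.const 0)) .zero)
          (.seq (.nat 3 (.var 14) (.const 0) (.const 1)) Code.addArc) .skip))
      .skip)
    (by simp [Code.WellFormed, Code.natWrites, Code.addArc])
    (I := fun i s' => Encodes D r
      (fun a => if (a : ℕ) < i ∧ D.Enters a S then red a - d else red a)
      {a | a ∈ mark ∨ ((a : ℕ) < i ∧ D.Enters a S ∧ red a = d)} rep s' ∧ s'.real 1 0 0 = d) s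
    ⟨by simpa using h0, hd⟩ ?_
  · rw [h.arcs] at hI
    have h1 := hI.1
    simp only [Fin.is_lt, true_and] at h1
    exact h1
  · rintro i hi s' hc hfr - ⟨hE, hd'⟩
    rw [h.arcs] at hi
    obtain ⟨a, rfl⟩ : ∃ a : Fin m, (a : ℕ) = i := ⟨⟨i, hi⟩, rfl⟩
    have hcount : ∀ (t : Memory) (x : ℕ), Encodes D r
        (fun b => if (b : ℕ) < a + 1 ∧ D.Enters b S then red b - d else red b)
        {b | b ∈ mark ∨ ((b : ℕ) < a + 1 ∧ D.Enters b S ∧ red b = d)} rep t →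
        Encodes D r
        (fun b => if (b : ℕ) < a + 1 ∧ D.Enters b S then red b - d else red b)
        {b | b ∈ mark ∨ ((b : ℕ) < a + 1 ∧ D.Enters b S ∧ red b = d)} rep
          (t.setNat 14 0 0 x) := by
      intro t x ht
      exact ht.congr (ht.toDescribes.congr (by funext i j; simp) (by funext i j; simp)
        (by funext i j; simp)) (by funext i j; simp) (by funext i j; simp)
        (by funext i j; simp) rfl
    have hlt : ∀ b : Fin m, (b : ℕ) < a + 1 ↔ (b : ℕ) < a ∨ b = a := by
      intro b; rw [Fin.ext_iff]; omega
    have hent : Code.entersTest.Holds s' ↔ D.Enters a S := by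
      rw [Code.holds_entersTest hc]
      exact hE.toDescribes.entersAt_iff (fun u => by
        rw [hfr 10 (by decide) (by decide)]; exact hS u) a
    suffices H : Encodes D r
        (fun b => if (b : ℕ) < a + 1 ∧ D.Enters b S then red b - d else red b)
        {b | b ∈ mark ∨ ((b : ℕ) < a + 1 ∧ D.Enters b S ∧ red b = d)} rep
        (Code.den (.ite Code.entersTest
          (.seq (.real 0 (.var 14) (.const 0)
              (.sub (.read 0 (.var 14) (.const 0)) (.read 1 (.const 0) (.const 0))))
            (.ite (.realEq (.read 0 (.var 14) (.const 0)) .zero)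
              (.seq (.nat 3 (.var 14) (.const 0) (.const 1)) Code.addArc) .skip))
          .skip) s') from
      ⟨hcount _ _ H, by
        rw [Memory.setNat_real, Code.den_real_of_notMem (by decide), hd']⟩
    by_cases ha : D.Enters a S
    · rw [Code.den, if_pos (hent.2 ha), Code.den]
      set s₁ := (Code.real 0 (.var 14) (.const 0)
        (.sub (.read 0 (.var 14) (.const 0)) (.read 1 (.const 0) (.const 0)))).den s' with hs₁
      have hs₁r : ∀ b : Fin m, s₁.real 0 b 0 =
          if (b : ℕ) < a + 1 ∧ D.Enters b S then red b - d else red b := by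
        intro b
        simp only [hs₁, Code.den, NatExpr.eval, RealExpr.eval, NatExpr.var, hc,
          Memory.setReal_real, hE.red_eq, hd', hlt, true_and, and_true]
        by_cases hb : b = a
        · subst hb; simp [ha]
        · have : (b : ℕ) ≠ a := fun h => hb (Fin.ext h)
          simp [hb, this]
      have hs₁a : s₁.real 0 a 0 = red a - d := by rw [hs₁r, if_pos ⟨Nat.lt_succ_self _, ha⟩]
      have hs₁n : s₁.nat = s'.nat := rfl
      have hs₁D : Describes D r s₁ := hE.toDescribes.congr rfl rfl rfl
      have htest : Test.Holds s₁ (.realEq (.read 0 (.var 14) (.const 0)) .zero) ↔ red a = d := by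
        simp only [Test.Holds, RealExpr.eval, NatExpr.eval, NatExpr.var, hs₁n, hc, hs₁a, sub_eq_zero]
      rw [Code.den]
      by_cases hred : red a = d
      · have hmarkeq : {b : Fin m | b ∈ mark ∨ ((b : ℕ) < a + 1 ∧ D.Enters b S ∧ red b = d)} =
            insert a {b : Fin m | b ∈ mark ∨ ((b : ℕ) < a ∧ D.Enters b S ∧ red b = d)} := by
          ext b
          simp only [Set.mem_ofPred_eq, Set.mem_insert_iff, hlt]
          constructor
          · rintro (h1 | ⟨h1 | h1, h2⟩)
            · exact Or.inr (Or.inl h1)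
            · exact Or.inr (Or.inr ⟨h1, h2⟩)
            · exact Or.inl h1
          · rintro (rfl | h1 | ⟨h1, h2⟩)
            · exact Or.inr ⟨Or.inr rfl, ha, hred⟩
            · exact Or.inl h1
            · exact Or.inr ⟨Or.inl h1, h2⟩
        rw [if_pos (htest.2 hred), Code.den]
        set s₂ := (Code.nat 3 (.var 14) (.const 0) (.const 1)).den s₁ with hs₂
        have hs₂n : ∀ T, T ≠ 3 → s₂.nat T = s'.nat T := fun T hT =>
          Code.den_nat_of_notMem (by simpa [Code.natWrites] using hT) s₁
        have hs₂3 : ∀ b : Fin m, s₂.nat 3 b 0 = if b = a then 1 else s'.nat 3 b 0 := by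
          intro b
          simp [hs₂, Code.den, NatExpr.eval, NatExpr.var, hs₁n, hc, Fin.ext_iff]
        have hs₂D : Describes D r s₂ := hs₁D.congr (hs₂n 0 (by decide)) (hs₂n 1 (by decide))
          (hs₂n 2 (by decide))
        have hadd := Code.den_addArc s₂ hs₂D.nodes (x := D.tail a) (y := D.head a)
          (by rw [hs₂n 14 (by decide), hc, hs₂D.tail]) (by rw [hs₂n 14 (by decide), hc, hs₂D.head])
        refine ⟨describes_den hs₂D (by decide) (by decide) (by decide), fun b => ?_, fun b => ?_,
          fun u v => ?_, fun u v => ?_⟩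
        · rw [Code.den_nat_of_notMem (by decide), hs₂3, hmarkeq, Set.mem_insert_iff, ← hE.mark_iff]
          by_cases hb : b = a <;> simp [hb]
        · rw [Code.den_real_of_notMem (by decide)]
          exact hs₁r b
        · rw [Code.den_nat_of_notMem (by decide), hs₂n 8 (by decide), hE.rep_eq]
        · rw [hadd u u.2 v v.2, hs₂n 9 (by decide), hE.reach_iff, hE.reach_iff, hE.reach_iff, hmarkeq,
            MultiDigraph.reach_insert_iff]
      · have hmarkeq : {b : Fin m | b ∈ mark ∨ ((b : ℕ) < a + 1 ∧ D.Enters b S ∧ red b = d)} =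
            {b : Fin m | b ∈ mark ∨ ((b : ℕ) < a ∧ D.Enters b S ∧ red b = d)} := by
          ext b
          simp only [Set.mem_ofPred_eq, hlt]
          refine or_congr_right ⟨?_, fun h1 => ⟨Or.inl h1.1, h1.2⟩⟩
          rintro ⟨h1 | rfl, h2⟩
          · exact ⟨h1, h2⟩
          · exact absurd h2.2 hred
        rw [if_neg (mt htest.1 hred), hmarkeq]
        exact ⟨hs₁D, hE.mark_iff, hs₁r, hE.rep_eq, hE.reach_iff⟩
    · rw [Code.den, if_neg (mt hent.1 ha), Code.den]
      have e1 : (fun b : Fin m => if (b : ℕ) < a + 1 ∧ D.Enters b S then red b - d else red b) =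
          fun b : Fin m => if (b : ℕ) < a ∧ D.Enters b S then red b - d else red b := by
        funext b
        refine if_congr ?_ rfl rfl
        rw [hlt]
        refine ⟨?_, fun h1 => ⟨Or.inl h1.1, h1.2⟩⟩
        rintro ⟨h1 | rfl, h2⟩
        · exact ⟨h1, h2⟩
        · exact absurd h2 ha
      have e2 : {b : Fin m | b ∈ mark ∨ ((b : ℕ) < a + 1 ∧ D.Enters b S ∧ red b = d)} =
          {b : Fin m | b ∈ mark ∨ ((b : ℕ) < a ∧ D.Enters b S ∧ red b = d)} := by
        ext b
        simp only [Set.mem_ofPred_eq, hlt]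
        refine or_congr_right ⟨?_, fun h1 => ⟨Or.inl h1.1, h1.2⟩⟩
        rintro ⟨h1 | rfl, h2⟩
        · exact ⟨h1, h2⟩
        · exact absurd h2.1 ha
      rw [e1, e2]
      exact hE

end Encoding

/-! ### The main loop -/

section Rounds

variable {n m : ℕ} {D : MultiDigraph (Fin n) (Fin m)} {r : Fin n} {c : Fin m → ℝ}
  {red : Fin m → ℝ} {mark : Set (Fin m)} {rep : Fin n → Fin n → Fin n}

theorem MultiDigraph.not_isArborescence_of_not_enters {V A : Type*} [Fintype V]
    {D : MultiDigraph V A} {r : V} {S : Finset V} (hS : S.Nonempty) (hr : r ∉ S)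
    (h : ∀ a, ¬ D.Enters a S) (B : Finset A) : ¬ D.IsArborescence r B := by
  intro hB
  obtain ⟨h1, h2⟩ := D.isArborescence_iff.1 hB
  obtain ⟨v, hv⟩ := hS
  obtain ⟨a, -, ha⟩ := (h1.reach h2 v).exists_enters hr hv
  exact h a ha

/-- A round finds everything reached, or a set without entering arcs that refutes all arborescences,
or marks at least one new arc. The last case is the measure of progress. -/
theorem den_round {s : Memory} (hE : Encodes D r red mark rep s)
    (hst : ∃ k Z δ τ, Stage D r c k Z δ τ red mark rep) :
    ((∀ v, D.Reach mark r v) ∧ Encodes D r red mark rep (Code.round.den s) ∧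
        (Code.round.den s).nat 12 = s.nat 12) ∨
      ((∀ B, ¬ D.IsArborescence r B) ∧ Encodes D r red mark rep (Code.round.den s) ∧
        (Code.round.den s).nat 12 0 0 = 1) ∨
      ∃ red' mark' rep', Encodes D r red' mark' rep' (Code.round.den s) ∧
        (∃ k Z δ τ, Stage D r c k Z δ τ red' mark' rep') ∧ mark ⊂ mark' ∧
        (Code.round.den s).nat 12 = s.nat 12 := by
  classical
  rw [Code.round, Code.den]
  have hE₁ := hE.den (p := Code.findUnreached) (by decide) (by decide)
  have hF := Code.den_findUnreached s hE.nodes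
  have hfr₁ : ∀ T, T ∉ Code.findUnreached.natWrites →
      (Code.findUnreached.den s).nat T = s.nat T := fun T hT => Code.den_nat_of_notMem hT s
  set s₁ := Code.findUnreached.den s
  rw [hE.root] at hF
  have htest : Test.Holds s₁ (.natLt (.var 11) (.read 0 (.const 0) (.const 0))) ↔
      s₁.nat 11 0 0 < n := by
    simp only [Test.Holds, NatExpr.var, NatExpr.eval, hE₁.nodes]
  rw [Code.den]
  rcases hF with ⟨h1, h2⟩ | ⟨h1, h2⟩
  · left
    rw [if_neg (fun h => by have := htest.1 h; omega), Code.den]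
    exact ⟨fun v => (hE.reach_iff r v).1 (h2 v v.2), hE₁, hfr₁ 12 (by decide)⟩
  right
  rw [if_pos (htest.2 h1), Code.den]
  have hE₂ := hE₁.den (p := Code.descend) (by decide) (by decide)
  have hdesc := Code.den_descend s₁ hE₁.nodes (r := r) r.2
    (fun u hu => (hE₁.reach_iff ⟨u, hu⟩ ⟨u, hu⟩).2 Relation.ReflTransGen.refl)
    (fun u hu v hv w hw huv hvw => (hE₁.reach_iff ⟨u, hu⟩ ⟨w, hw⟩).2
      (((hE₁.reach_iff ⟨u, hu⟩ ⟨v, hv⟩).1 huv).trans ((hE₁.reach_iff ⟨v, hv⟩ ⟨w, hw⟩).1 hvw)))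
    h1 (by rw [hfr₁ 9 (by decide)]; exact h2)
  have hfr₂ : ∀ T, T ∉ Code.descend.natWrites → (Code.descend.den s₁).nat T = s₁.nat T :=
    fun T hT => Code.den_nat_of_notMem hT s₁
  set s₂ := Code.descend.den s₁
  obtain ⟨w', hw', h11, hnr, hsrc⟩ := hdesc
  obtain ⟨w, rfl⟩ : ∃ w : Fin n, (w : ℕ) = w' := ⟨⟨w', hw'⟩, rfl⟩
  have hsrc' : ∀ u : Fin n, D.Reach mark u w → D.Reach mark w u ∧ w ≤ u := by
    intro u hu
    have := hsrc u u.2 ((hE₁.reach_iff u w).2 hu)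
    exact ⟨(hE₁.reach_iff w u).1 this.1, this.2⟩
  rw [Code.den]
  have hE₃ := hE₂.den (p := Code.copySet) (by decide) (by decide)
  have hcopy := Code.den_copySet s₂ hE₂.nodes
  have hfr₃ : ∀ T, T ∉ Code.copySet.natWrites → (Code.copySet.den s₂).nat T = s₂.nat T :=
    fun T hT => Code.den_nat_of_notMem hT s₂
  set s₃ := Code.copySet.den s₂
  let S : Finset (Fin n) := Finset.univ.filter fun u => D.Reach mark u w
  have hSmem : ∀ u, u ∈ S ↔ D.Reach mark u w := by simp [S]
  have hS₃ : ∀ u : Fin n, s₃.nat 10 u 0 = 1 ↔ u ∈ S := by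
    intro u
    rw [hcopy u u.2, h11, hE₂.reach_iff, hSmem]
  rw [Code.den]
  have hE₄ := hE₃.den (p := Code.findMin) (by decide) (by decide)
  have hmin := Code.den_findMin s₃ hE₃.arcs
  have hfr₄ : ∀ T, T ∉ Code.findMin.natWrites → (Code.findMin.den s₃).nat T = s₃.nat T :=
    fun T hT => Code.den_nat_of_notMem hT s₃
  set s₄ := Code.findMin.den s₃
  have hent : ∀ a : Fin m, Code.EntersAt s₃ a ↔ D.Enters a S :=
    fun a => hE₃.toDescribes.entersAt_iff hS₃ a
  have hwS : w ∈ S := (hSmem w).2 Relation.ReflTransGen.refl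
  have hrS : r ∉ S := fun h => hnr ((hE₁.reach_iff r w).2 ((hSmem r).1 h))
  have h12 : s₄.nat 12 = s.nat 12 := by
    rw [hfr₄ 12 (by decide), hfr₃ 12 (by decide), hfr₂ 12 (by decide), hfr₁ 12 (by decide)]
  have htest' : Test.Holds s₄ (.natEq (.var 13) (.const 1)) ↔ s₄.nat 13 0 0 = 1 := by
    simp only [Test.Holds, NatExpr.var, NatExpr.eval]
  rw [Code.den]
  rcases hmin with ⟨h13, hno⟩ | ⟨h13, ⟨a, ha, haE, had⟩, hle⟩
  · left
    rw [if_neg (fun h => by have := htest'.1 h; omega)]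
    refine ⟨MultiDigraph.not_isArborescence_of_not_enters ⟨w, hwS⟩ hrS
      fun a h => hno a a.2 ((hent a).2 h), hE₄.den (by decide) (by decide), ?_⟩
    simp [Code.den, NatExpr.eval]
  right
  rw [if_pos (htest'.2 h13), Code.den]
  set d := s₄.real 1 0 0 with hd
  have hS₄ : ∀ u : Fin n, s₄.nat 10 u 0 = 1 ↔ u ∈ S := by
    intro u; rw [hfr₄ 10 (by decide)]; exact hS₃ u
  have hE₅ := hE₄.den_lowerCosts hS₄ hd.symm
  have hfr₅ : ∀ T, T ∉ Code.lowerCosts.natWrites → (Code.lowerCosts.den s₄).nat T = s₄.nat T :=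
    fun T hT => Code.den_nat_of_notMem hT s₄
  set s₅ := Code.lowerCosts.den s₄
  have hrep := Code.den_updateReps s₅ hE₅.nodes
  have hS₅ : ∀ u : Fin n, s₅.nat 10 u 0 = 1 ↔ u ∈ S := by
    intro u; rw [hfr₅ 10 (by decide)]; exact hS₄ u
  have h11' : s₅.nat 11 0 0 = w := by
    rw [hfr₅ 11 (by decide), hfr₄ 11 (by decide), hfr₃ 11 (by decide), h11]
  have haE' : D.Enters ⟨a, ha⟩ S := (hent ⟨a, ha⟩).1 haE
  have had' : red ⟨a, ha⟩ = d := by rw [← had, ← hE₃.red_eq]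
  obtain ⟨k, Z, δ, τ, hStage⟩ := hst
  refine ⟨_, _, fun u v => if u ∈ S ∧ v ∉ S then w else rep u v,
    ⟨describes_den hE₅.toDescribes (by decide) (by decide) (by decide), fun b => ?_, fun b => ?_,
      fun u v => ?_, fun u v => ?_⟩,
    ⟨k + 1, hStage.step (v₀ := w) (S := S) (d := d) hSmem
      (fun h => hrS ((hSmem r).2 h)) (fun u hu => (hsrc' u ((hSmem u).1 hu)).1)
      (fun u hu => (hsrc' u ((hSmem u).1 hu)).2) ⟨⟨a, ha⟩, haE', had'⟩
      (fun b hb => by rw [← hE₃.red_eq]; exact hle b b.2 ((hent b).2 hb))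
      (fun b => rfl) (fun b => Iff.rfl) fun u v => rfl⟩, ?_, ?_⟩
  · rw [Code.den_nat_of_notMem (by decide)]; exact hE₅.mark_iff b
  · rw [Code.den_real_of_notMem (by decide)]; exact hE₅.red_eq b
  · rw [hrep u u.2 v v.2, hE₅.rep_eq, h11']
    simp only [ne_eq, hS₅]
    split_ifs <;> rfl
  · rw [Code.den_nat_of_notMem (by decide)]; exact hE₅.reach_iff u v
  -- The arc attaining the minimum is new: were it marked before, its tail would reach `w` and lie
  -- in `S`.
  · refine (Set.ssubset_iff_of_subset fun b hb => Or.inl hb).2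
      ⟨⟨a, ha⟩, Or.inr ⟨haE', had'⟩, fun h => haE'.1 ?_⟩
    exact (hSmem _).2 (Relation.ReflTransGen.head ⟨_, h, rfl, rfl⟩ ((hSmem _).1 haE'.2))
  · rw [Code.den_nat_of_notMem (by decide), hfr₅ 12 (by decide), h12]

/-- The invariant of the main loop. -/
def RoundInvariant (D : MultiDigraph (Fin n) (Fin m)) (r : Fin n) (c : Fin m → ℝ) (i : ℕ)
    (s : Memory) : Prop :=
  ∃ red mark rep, Encodes D r red mark rep s ∧
    (∃ k Z δ τ, Stage D r c k Z δ τ red mark rep) ∧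
    (s.nat 12 0 0 = 0 ∨ (s.nat 12 0 0 = 1 ∧ ∀ B, ¬ D.IsArborescence r B)) ∧
    (s.nat 12 0 0 = 1 ∨ (∀ v, D.Reach mark r v) ∨ i ≤ mark.ncard)

/-- Reaching all nodes and failure both persist; otherwise the number of marks grows with the number
of rounds. -/
theorem RoundInvariant.den_round {i : ℕ} {s : Memory} (h : RoundInvariant D r c i s) :
    RoundInvariant D r c (i + 1) (Code.round.den s) := by
  obtain ⟨red, mark, rep, hE, hst, h1, h2⟩ := h
  rcases OptArb.den_round hE hst with ⟨h3, h4, h5⟩ | ⟨h3, h4, h5⟩ |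
    ⟨red', mark', rep', h3, h4, h5, h6⟩
  · exact ⟨red, mark, rep, h4, hst, by rw [h5]; exact h1, Or.inr (Or.inl h3)⟩
  · exact ⟨red, mark, rep, h4, hst, Or.inr ⟨h5, h3⟩, Or.inl h5⟩
  · refine ⟨red', mark', rep', h3, h4, by rw [h6]; exact h1, ?_⟩
    rw [h6]
    refine h2.imp_right fun h7 => ?_
    rcases h7 with h7 | h7
    · left
      intro v
      exact Relation.ReflTransGen.mono (r := D.Arc mark)
        (fun _ _ ⟨b, hb, h8⟩ => ⟨b, h5.1 hb, h8⟩) _ _ (h7 v)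
    · right
      have := Set.ncard_lt_ncard h5 (Set.toFinite _)
      omega

theorem RoundInvariant.setNat {i x : ℕ} {s : Memory} (h : RoundInvariant D r c i s) :
    RoundInvariant D r c i (s.setNat 17 0 0 x) := by
  obtain ⟨red, mark, rep, hE, hst, h1, h2⟩ := h
  have hT : ∀ T, T ≠ 17 → (s.setNat 17 0 0 x).nat T = s.nat T := by
    intro T hT; funext i j; simp [hT]
  exact ⟨red, mark, rep, hE.congr (hE.toDescribes.congr (hT 0 (by decide)) (hT 1 (by decide))
    (hT 2 (by decide))) (hT 3 (by decide)) (hT 8 (by decide)) (hT 9 (by decide)) rfl, hst,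
    by rw [hT 12 (by decide)]; exact h1, by rw [hT 12 (by decide)]; exact h2⟩

/-- After one round more than arcs, the method has failed or all nodes are reached. -/
theorem den_rounds {s : Memory} (h : RoundInvariant D r c 0 s) :
    ∃ red mark rep, Encodes D r red mark rep
        ((Code.seq (.loop 17 1 Code.round) Code.round).den s) ∧
      (∃ k Z δ τ, Stage D r c k Z δ τ red mark rep) ∧
      ((((Code.seq (.loop 17 1 Code.round) Code.round).den s).nat 12 0 0 = 1 ∧
          ∀ B, ¬ D.IsArborescence r B) ∨
        (((Code.seq (.loop 17 1 Code.round) Code.round).den s).nat 12 0 0 ≠ 1 ∧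
          ∀ v, D.Reach mark r v)) := by
  have hm : s.nat 0 1 0 = m := by
    obtain ⟨_, _, _, hE, -⟩ := h
    exact hE.arcs
  have hwf : (Code.loop 17 1 Code.round).WellFormed := by
    simp [Code.round, Code.findUnreached, Code.descend, Code.copySet,
      Code.findMin, Code.lowerCosts, Code.addArc, Code.updateReps, Code.WellFormed,
      Code.natWrites]
  have h1 := Code.den_loop hwf (I := RoundInvariant D r c) s h.setNat
    fun i _ s' _ _ _ hs' => hs'.den_round.setNat
  rw [hm] at h1
  have h2 := h1.den_round
  rw [Code.den]
  obtain ⟨red, mark, rep, hE, hst, h3, h4⟩ := h2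
  refine ⟨red, mark, rep, hE, hst, ?_⟩
  rcases h3 with h3 | h3
  · right
    refine ⟨by omega, ?_⟩
    rcases h4 with h4 | h4 | h4
    · omega
    · exact h4
    -- The additional round after the loop makes `m + 1` rounds, and only `m` arcs can be marked.
    · have := Set.ncard_le_card mark
      rw [Nat.card_eq_fintype_card, Fintype.card_fin] at this
      omega
  · exact Or.inl h3

theorem describes_input : Describes D r (input D r c) :=
  ⟨rfl, rfl, rfl, fun a => by simp [input], fun a => by simp [input]⟩

theorem roundInvariant_initTables :
    RoundInvariant D r c 0 (Code.initTables.den (input D r c)) := by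
  have h := Code.den_initTables (input D r c) (n := n) rfl (fun _ _ => rfl)
  have hfr : ∀ T, T ∉ Code.initTables.natWrites →
      (Code.initTables.den (input D r c)).nat T = (input D r c).nat T :=
    fun T hT => Code.den_nat_of_notMem hT _
  refine ⟨c, ∅, fun u _ => u, ⟨describes_den describes_input (by decide) (by decide) (by decide),
    fun a => ?_, fun a => ?_, fun u v => h.1 u u.2 v v.2, fun u v => ?_⟩,
    ⟨0, _, _, _, Stage.init D r c (fun _ => ∅) (fun _ => 0) (fun _ => 0)⟩, Or.inl ?_,
    Or.inr (Or.inr (Nat.zero_le _))⟩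
  · rw [hfr 3 (by decide)]
    simp [input]
  · rw [Code.den_real_of_notMem (by decide)]
    simp [input]
  · rw [h.2 u u.2 v v.2, Fin.val_inj]
    constructor
    · rintro rfl; exact Relation.ReflTransGen.refl
    · intro huv
      rcases Relation.ReflTransGen.cases_head huv with h1 | ⟨w, ⟨a, ha, -⟩, -⟩
      · exact h1
      · exact absurd ha (Set.notMem_empty a)
  · rw [hfr 12 (by decide)]; rfl

end Rounds

/-! ### The output -/

section Output

theorem exists_isOutputGraph {m : ℕ} (s : Memory)
    (h : ∀ a ∈ outputArcs m s, s.nat 5 a 0 < s.nat 4 0 0 ∧ s.nat 6 a 0 < s.nat 4 0 0) :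
    ∃ G : Graph ℕ (Fin m), IsOutputGraph s G :=
  ⟨{ vertexSet := Set.Iio (s.nat 4 0 0)
     IsLink := fun a x y => a ∈ outputArcs m s ∧
       ((s.nat 5 a 0 = x ∧ s.nat 6 a 0 = y) ∨ (s.nat 5 a 0 = y ∧ s.nat 6 a 0 = x))
     isLink_symm := fun a _ => ⟨fun _ _ h => ⟨h.1, h.2.symm⟩⟩
     eq_or_eq_of_isLink_of_isLink := by
       rintro a x y v w ⟨-, ⟨rfl, rfl⟩ | ⟨rfl, rfl⟩⟩ ⟨-, ⟨rfl, rfl⟩ | ⟨rfl, rfl⟩⟩ <;> simp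
     left_mem_of_isLink := by
       rintro a x y ⟨ha, ⟨rfl, -⟩ | ⟨-, rfl⟩⟩
       · exact (h a ha).1
       · exact (h a ha).2 },
    rfl, fun _ _ _ => Iff.rfl⟩

theorem exists_isOutput {m : ℕ} (s : Memory)
    (h : ∀ a ∈ outputArcs m s, s.nat 5 a 0 < s.nat 4 0 0 ∧ s.nat 6 a 0 < s.nat 4 0 0) :
    ∃ M₁ M₂ : Matroid (Fin m), IsOutput s (outputArcs m s) M₁ M₂ := by
  obtain ⟨G, hG⟩ := exists_isOutputGraph s h
  obtain ⟨M₁, -, h1⟩ := exists_isCycleMatroid hG.2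
  obtain ⟨M₂, h2⟩ := exists_isPartitionMatroid (outputArcs m s) (outputLabel s)
  exact ⟨M₁, M₂, rfl, ⟨G, hG, h1⟩, h2⟩

theorem Code.den_writeFailure (s : Memory) {m : ℕ} (hm : s.nat 0 1 0 = m) :
    (Code.writeFailure.den s).nat 4 0 0 = 1 ∧
      ∀ a < m, ((Code.writeFailure.den s).nat 3 a 0 = 1 ↔ a = 0) := by
  have h := Code.den_loop (C := 14) (b := 1) (p := .nat 3 (.var 14) (.const 0) (.const 0))
    (by simp [Code.WellFormed, Code.natWrites])
    (I := fun i s' => ∀ a < i, s'.nat 3 a 0 = 0) s (by simp) (by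
      intro i _ s' hc _ _ hI a ha
      simp only [Code.den, NatExpr.eval, NatExpr.var, hc, Memory.setNat_nat]
      rcases Nat.lt_succ_iff_lt_or_eq.1 ha with ha | rfl
      · simp [ha.ne, hI a ha]
      · simp)
  rw [hm] at h
  rw [Code.writeFailure, Code.den]
  set s₁ := (Code.loop 14 1 (.nat 3 (.var 14) (.const 0) (.const 0))).den s
  refine ⟨by simp [Code.den, NatExpr.eval], fun a ha => ?_⟩
  simp only [Code.den, NatExpr.eval, Memory.setNat_nat]
  by_cases h0 : a = 0
  · simp [h0]
  · simp [h0, h a ha]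

theorem Code.den_writeMatroids (s : Memory) {m : ℕ} (hm : s.nat 0 1 0 = m) :
    (Code.writeMatroids.den s).nat 4 0 0 = s.nat 0 0 0 ∧
      ∀ a < m, (Code.writeMatroids.den s).nat 5 a 0 = s.nat 8 (s.nat 1 a 0) (s.nat 2 a 0) ∧
        (Code.writeMatroids.den s).nat 6 a 0 = s.nat 8 (s.nat 2 a 0) (s.nat 1 a 0) ∧
        (Code.writeMatroids.den s).nat 7 a 0 = s.nat 2 a 0 := by
  rw [Code.writeMatroids, Code.den]
  set s₁ := (Code.nat 4 (.const 0) (.const 0) (.read 0 (.const 0) (.const 0))).den s with hs₁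
  have hfr : ∀ T, T ≠ 4 → s₁.nat T = s.nat T := fun T hT =>
    Code.den_nat_of_notMem (by simpa [Code.natWrites] using hT) s
  refine ⟨?_, ?_⟩
  · rw [Code.den_nat_of_notMem (by decide)]
    simp [hs₁, Code.den, NatExpr.eval]
  · have h := Code.den_loop (C := 14) (b := 1) (p := .seq
      (.nat 5 (.var 14) (.const 0)
        (.read 8 (.read 1 (.var 14) (.const 0)) (.read 2 (.var 14) (.const 0))))
      (.seq
        (.nat 6 (.var 14) (.const 0)
          (.read 8 (.read 2 (.var 14) (.const 0)) (.read 1 (.var 14) (.const 0))))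
        (.nat 7 (.var 14) (.const 0) (.read 2 (.var 14) (.const 0)))))
      (by simp [Code.WellFormed, Code.natWrites])
      (I := fun i s' => ∀ a < i, s'.nat 5 a 0 = s.nat 8 (s.nat 1 a 0) (s.nat 2 a 0) ∧
        s'.nat 6 a 0 = s.nat 8 (s.nat 2 a 0) (s.nat 1 a 0) ∧ s'.nat 7 a 0 = s.nat 2 a 0) s₁
      (by simp) (by
        intro i _ s' hc hfr' _ hI a ha
        have e1 : s'.nat 1 = s.nat 1 := by
          rw [hfr' 1 (by decide) (by decide), hfr 1 (by decide)]
        have e2 : s'.nat 2 = s.nat 2 := by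
          rw [hfr' 2 (by decide) (by decide), hfr 2 (by decide)]
        have e8 : s'.nat 8 = s.nat 8 := by
          rw [hfr' 8 (by decide) (by decide), hfr 8 (by decide)]
        rcases Nat.lt_succ_iff_lt_or_eq.1 ha with ha | rfl
        · simp [Code.den, NatExpr.eval, NatExpr.var, hc, ha.ne, hI a ha]
        · simp [Code.den, NatExpr.eval, NatExpr.var, hc, e1, e2, e8])
    rw [hfr 0 (by decide), hm] at h
    exact h

variable {n m : ℕ} {D : MultiDigraph (Fin n) (Fin m)} {r : Fin n} {c : Fin m → ℝ}

/-- The heads of the marked arcs are exactly the nodes other than `r`, so bases of `M₂` are the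
marked sets of in-degree one. These have the size of a spanning tree, and such a set is a base of
`M₁` exactly if it connects the glued graph. -/
theorem isMinCostArborescence_iff_isBase {red : Fin m → ℝ} {mark : Set (Fin m)}
    {rep : Fin n → Fin n → Fin n} (hst : ∃ k Z δ τ, Stage D r c k Z δ τ red mark rep)
    (hreach : ∀ v, D.Reach mark r v) {s : Memory} (hmark : outputArcs m s = mark)
    (h5 : ∀ a : Fin m, s.nat 5 a 0 = rep (D.tail a) (D.head a))
    (h6 : ∀ a : Fin m, s.nat 6 a 0 = rep (D.head a) (D.tail a))
    (h7 : ∀ a : Fin m, s.nat 7 a 0 = D.head a) {M₁ M₂ : Matroid (Fin m)}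
    (hout : IsOutput s (outputArcs m s) M₁ M₂) (B : Finset (Fin m)) :
    D.IsMinCostArborescence r c B ↔ (B : Set (Fin m)) ⊆ outputArcs m s ∧
      M₁.IsBase (B : Set (Fin m)) ∧ M₂.IsBase (B : Set (Fin m)) := by
  obtain ⟨k, Z, δ, τ, hS⟩ := hst
  obtain ⟨-, ⟨G, hG, hM₁⟩, hM₂⟩ := hout
  rw [hS.isMinCostArborescence_iff hreach, hS.tight_iff, hmark]
  refine and_congr_right fun hB => ?_
  have hdeg : M₂.IsBase (B : Set (Fin m)) ↔ D.InDegOne r B := by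
    have hlabel : ∀ a b : Fin m, outputLabel s a = outputLabel s b ↔ D.head a = D.head b := by
      intro a b
      rw [outputLabel, outputLabel, h7, h7, Fin.val_inj]
    rw [hM₂.isBase_iff, hmark]
    simp only [hlabel]
    constructor
    · rintro ⟨-, h⟩
      refine ⟨fun a ha => hS.head_ne_root (hB ha), fun v hv => ?_⟩
      rcases Relation.ReflTransGen.cases_tail (hreach v) with h1 | ⟨w, -, a, ha, -, rfl⟩
      · exact absurd h1 hv
      · exact h a ha
    · intro h
      exact ⟨hB, fun e he => h.2 _ (hS.head_ne_root he)⟩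
  rw [hdeg, and_comm]
  refine and_congr_left fun hd => ?_
  refine (hM₁.isBase_iff_conn (ι := Fin.val) Fin.val_injective (S := mark) (fun a x y => ?_) r
    hB hd.card_add_one).symm
  rw [hG.2, hmark, h5, h6]

/-- A base of `M₂` must contain the only element, which is a loop of `M₁`. -/
theorem not_isBase_of_loop {s : Memory} {a₀ : Fin m} (h3 : outputArcs m s = {a₀})
    (h56 : s.nat 5 a₀ 0 = s.nat 6 a₀ 0) {M₁ M₂ : Matroid (Fin m)}
    (hout : IsOutput s (outputArcs m s) M₁ M₂) (B : Finset (Fin m)) :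
    ¬ (M₁.IsBase (B : Set (Fin m)) ∧ M₂.IsBase (B : Set (Fin m))) := by
  rintro ⟨h1, h2⟩
  obtain ⟨-, ⟨G, hG, hM₁⟩, hM₂⟩ := hout
  obtain ⟨hBS, hu⟩ := hM₂.isBase_iff.1 h2
  obtain ⟨f, ⟨hf, -⟩, -⟩ := hu a₀ (by rw [h3]; rfl)
  have hfa : f = a₀ := by have := hBS hf; rwa [h3] at this
  subst hfa
  refine ((hM₁.2 _).1 h1.indep).2 ⟨1, fun _ => s.nat 5 f 0, fun _ => f, one_pos, rfl, ?_, ?_, ?_⟩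
  · intro i hi j hj _
    rw [Set.mem_Iio] at hi hj; omega
  · intro i hi j hj _
    rw [Set.mem_Iio] at hi hj; omega
  · exact fun i _ => ⟨hf, (hG.2 _ _ _).2 ⟨hBS hf, Or.inl ⟨rfl, h56.symm⟩⟩⟩

theorem isArborescence_empty (D : MultiDigraph (Fin 1) (Fin m)) (r : Fin 1) :
    D.IsArborescence r ∅ := by
  refine ⟨by simp, fun v hv => absurd (Subsingleton.elim v r) hv, ?_⟩
  rintro ⟨k, v, e, hk, -, -, -, h⟩
  simpa using (h 0 hk).1

end Output

end OptArb

/-! ### The two outcomes of the run -/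

theorem mainTheorem4 :
    ∃ (P : OptArb.Program) (q : Polynomial ℕ),
      ∀ (n m : ℕ) (D : OptArb.MultiDigraph (Fin n) (Fin m)) (r : Fin n) (c : Fin m → ℝ),
        (0 < m ∨ n = 1) →
        ∃ (t : ℕ) (s : OptArb.Memory),
          OptArb.Runs P (OptArb.input D r c) t s ∧ t ≤ q.eval (n + m) ∧
          ∃ (A' : Set (Fin m)) (M₁ M₂ : Matroid (Fin m)),
            OptArb.IsOutput s A' M₁ M₂ ∧
            ∀ B : Finset (Fin m),
              D.IsMinCostArborescence r c B ↔
                (B : Set (Fin m)) ⊆ A' ∧ M₁.IsBase (B : Set (Fin m)) ∧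
                  M₂.IsBase (B : Set (Fin m)) := by
  -- The cost polynomial is evaluated at `n + m`, a common bound for the two loop lengths `n` and
  -- `m`.
  refine ⟨OptArb.Code.main.compile, OptArb.Code.main.cost, fun n m D r c hnm => ?_⟩
  obtain ⟨t, hrun, ht⟩ := OptArb.Code.exists_runs OptArb.Code.wellFormed_main (N := n + m)
    (OptArb.input D r c) (by
      intro b hb
      interval_cases b
      · exact Nat.le_add_right n m
      · exact Nat.le_add_left m n)
  refine ⟨t, _, hrun, ht, ?_⟩
  obtain ⟨red, mark, rep, hE, hst, hcase⟩ :=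
    OptArb.den_rounds (OptArb.roundInvariant_initTables (D := D) (r := r) (c := c))
  rw [OptArb.Code.main, OptArb.Code.den, OptArb.Code.den]
  have hfr : ∀ T, T ∉ OptArb.Code.initTables.natWrites →
      T ∉ (OptArb.Code.seq (.loop 17 1 OptArb.Code.round) OptArb.Code.round).natWrites →
      ((OptArb.Code.seq (.loop 17 1 OptArb.Code.round) OptArb.Code.round).den
        (OptArb.Code.initTables.den (OptArb.input D r c))).nat T =
          (OptArb.input D r c).nat T := fun T h1 h2 => by
    rw [OptArb.Code.den_nat_of_notMem h2, OptArb.Code.den_nat_of_notMem h1]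
  set s := (OptArb.Code.seq (.loop 17 1 OptArb.Code.round) OptArb.Code.round).den
    (OptArb.Code.initTables.den (OptArb.input D r c))
  have htest : OptArb.Test.Holds s (.natEq (.var 12) (.const 1)) ↔ s.nat 12 0 0 = 1 := by
    simp only [OptArb.Test.Holds, OptArb.NatExpr.var, OptArb.NatExpr.eval]
  rw [OptArb.Code.den]
  rcases hcase with ⟨h12, hno⟩ | ⟨h12, hreach⟩
  · rw [if_pos (htest.2 h12)]
    -- The failure output needs an arc. Without arcs there is only the root, and the empty set is an
    -- arborescence.
    have hm : 0 < m := by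
      rcases hnm with h | rfl
      · exact h
      · exact absurd (OptArb.isArborescence_empty D r) (hno ∅)
    obtain ⟨h4, h3⟩ := OptArb.Code.den_writeFailure s hE.arcs
    -- The tables of ends have not been written and still hold `0`, so the output arc is a loop at
    -- node `0`.
    have hzero : ∀ T ∈ [5, 6], ∀ a : Fin m, (OptArb.Code.writeFailure.den s).nat T a 0 = 0 := by
      intro T hT a
      rcases List.mem_pair.1 hT with rfl | rfl
      · rw [OptArb.Code.den_nat_of_notMem (by decide), hfr 5 (by decide) (by decide)]; rfl
      · rw [OptArb.Code.den_nat_of_notMem (by decide), hfr 6 (by decide) (by decide)]; rfl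
    obtain ⟨M₁, M₂, hout⟩ := OptArb.exists_isOutput (m := m) (OptArb.Code.writeFailure.den s) (by
      intro a _
      rw [hzero 5 (by decide), hzero 6 (by decide), h4]
      exact ⟨one_pos, one_pos⟩)
    have harcs : OptArb.outputArcs m (OptArb.Code.writeFailure.den s) = {⟨0, hm⟩} := by
      ext a
      rw [Set.mem_singleton_iff, Fin.ext_iff]
      exact h3 a a.2
    refine ⟨_, M₁, M₂, hout, fun B => ⟨fun h => absurd h.1 (hno B), fun h => absurd h.2 ?_⟩⟩
    exact OptArb.not_isBase_of_loop harcs (by rw [hzero 5 (by decide), hzero 6 (by decide)]) hout B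
  · rw [if_neg (mt htest.1 h12)]
    obtain ⟨h4, h567⟩ := OptArb.Code.den_writeMatroids s hE.arcs
    have h5 : ∀ a : Fin m, (OptArb.Code.writeMatroids.den s).nat 5 a 0 =
        rep (D.tail a) (D.head a) := fun a => by
      rw [(h567 a a.2).1, hE.tail, hE.head, hE.rep_eq]
    have h6 : ∀ a : Fin m, (OptArb.Code.writeMatroids.den s).nat 6 a 0 =
        rep (D.head a) (D.tail a) := fun a => by
      rw [(h567 a a.2).2.1, hE.tail, hE.head, hE.rep_eq]
    have h7 : ∀ a : Fin m, (OptArb.Code.writeMatroids.den s).nat 7 a 0 = D.head a := fun a => by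
      rw [(h567 a a.2).2.2, hE.head]
    have hmark : OptArb.outputArcs m (OptArb.Code.writeMatroids.den s) = mark := by
      ext a
      rw [← hE.mark_iff a]
      change (OptArb.Code.writeMatroids.den s).nat 3 a 0 = 1 ↔ _
      rw [OptArb.Code.den_nat_of_notMem (by decide)]
    obtain ⟨M₁, M₂, hout⟩ := OptArb.exists_isOutput (m := m) (OptArb.Code.writeMatroids.den s) (by
      intro a _
      rw [h5, h6, h4, hE.nodes]
      exact ⟨Fin.is_lt _, Fin.is_lt _⟩)
    exact ⟨_, M₁, M₂, hout,
      OptArb.isMinCostArborescence_iff_isBase hst hreach hmark h5 h6 h7 hout⟩
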